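/- **Energy.** Let $v_2:(0,\infty)\to[-1,\infty)$ be smooth with $v_2(1)=-1$, $v_2(r)>-1$ for $r\ne1$, $v_2''(1)>0$, $v_2(r)=0$ for $r\ge 1.1$. Let $v_3:[0,2\pi]\to[0,\infty)$ be smooth with $v_3(\alpha)=v_3(2\pi-\alpha)$, $v_3(\alpha)=0$ exactly for $\alpha\in\{2\pi/3,4\pi/3\}$, and $v_3''(2\pi/3)>0$. For a configuration $\{x_1,\dots,x_n\}+Le_1\mathbb Z\subset\mathbb R^3$ with period $L>0$, let $|x_i-x_j|_L$ be the distance modulo $Le_1\mathbb Z$, call $i\neq j$ bonded if $|x_i-x_j|_L<1.1$, and set $$E=\frac12\sum_{(i,j)\ \text{bonded}}v_2(|x_i-x_j|_L)+\frac12\sum_{\substack{(i,j),(j,k)\ \text{bonded}\\ i\ne k}}v_3(\alpha_{ijk}),$$ where the sums run over ordered pairs and triples and $\alpha_{ijk}\in[0,\pi]$ is the angle at $x_j$ between the bonds to $x_i$ and $x_k$ (vectors taken modulo $Le_1\mathbb Z$). **Zigzag tubes.** For an integer $\ell>3$, $\mu\in(2.6,3.1)$ and $\lambda_1,\lambda_2\in(0.9,1.1)$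 put $\sigma=\mu/2-\lambda_1$ and let $\rho>0$ be given by $\sigma^2+4\rho^2\sin^2(\pi/(2\ell))=\lambda_2^2$. Let $\mathcal F_{\lambda_1,\lambda_2,\mu}$ consist of the points $$x_{i,k}^{j,l}=\Big(k(\lambda_1+\sigma)+j\mu+l(2\sigma+\lambda_1),\ \rho\cos\tfrac{\pi(2i+k)}{\ell},\ \rho\sin\tfrac{\pi(2i+k)}{\ell}\Big),\quad 1\le i\le\ell,\ j\in\mathbb Z,\ k,l\in\{0,1\}.$$ For $m\ge1$ it is regarded as having period $L=m\mu$, with $n=4m\ell$ atoms per period ($0\le j<m$), and $E$ is the energy for this $L$. **Unstretched tube.** Let $\gamma_\ell=\pi(1-1/\ell)$ and $\beta(\alpha)=2\arcsin(\sin\alpha\,\sin(\gamma_\ell/2))$, and let $\alpha^{\rm ch}_\ell$ be the unique solution of $\beta(\alpha)=\alpha$ in $(\arccos(-0.4),\arccos(-0.6))$. Write $\mathcal G_\alpha=\mathcal F_{1,1,2-2\cos\alpha}$. **Theorem (Fracture).** There are an open interval $A\subseteq(\arccos(-0.3),\arccos(-0.55))$, an integer $\ell_0>3$ and a constant $c>0$,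 depending only on $v_2,v_3$, such that the following holds for every $\ell\ge\ell_0$. There is an angle $\alpha^{\rm us}_\ell\in(\alpha^{\rm ch}_\ell,2\pi/3)\subseteq A$ which is the unique minimizer of $\alpha\mapsto E(\mathcal G_\alpha)$ on $A$ (for every $m \geq 1$; it does not depend on the choice of $A$). With $\mu^{\rm us}_\ell=2-2\cos\alpha^{\rm us}_\ell$ there is an open interval $M^\ell\subseteq(2.6,3.1)$ containing $\mu^{\rm us}_\ell$, depending only on $v_2,v_3,\ell$, such that for every $\mu\in M^\ell$ there is a pair $(\lambda_1^\mu,\lambda_2^\mu)$ which, for every $m\ge1$, is the unique minimizer of $E(\mathcal F_{\lambda_1,\lambda_2,\mu})$ over $\lambda_1,\lambda_2\in(0.9,1.1)$; write $\mathcal F^*_\mu=\mathcal F_{\lambda_1^\mu,\lambda_2^\mu,\mu}$. Moreover, for all $m\ge1$ and all $\mu\in M^\ell$ with $\mu\ge\mu^{\rm us}_\ell+c/\sqrt m$, $$E(\mathcal H_\mu)<E(\mathcal F^*_\mu),$$ where, $\bar x_{i,k}^{j,l}$ denoting the points of $\mathcal F_{1,1,\mu^{\rm us}_\ell}$, $\mathcal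 H_\mu$ is the configuration of period $L=m\mu$ along $e_1$ whose atoms in one period are, for $1\le i\le\ell$, $k,l\in\{0,1\}$, $$x_{i,k}^{j,l}=\begin{cases}\bar x_{i,k}^{j,l}, & 0\le j<m/2,\\ \bar x_{i,k}^{j,l}+m(\mu-\mu^{\rm us}_\ell)e_1, & m/2\le j<m.\end{cases}$$ -/

import Mathlib

open Real
open scoped ContDiff

namespace Nanotube

/-! ### Periodic configurations and their energy -/

/-- Points of three-dimensional Euclidean space. -/
abbrev Point := EuclideanSpace ℝ (Fin 3)

/-- The axis direction. -/
noncomputable def e₁ : Point := EuclideanSpace.single 0 1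

/-- The configuration `{pos i + t L e₁ : i ∈ ι, t ∈ ℤ}`. All quantities below are unchanged if a
representative `pos i` is moved by a multiple of `L e₁`, see `bondVec_add_period`, so the
representatives need not be taken with first coordinate in `[0, L)`. -/
structure Config (ι : Type) where
  pos : ι → Point
  period : ℝ

/-- The representative of `x - y` modulo the period `L` along the axis whose axial coordinate is
smallest in absolute value. -/
noncomputable def bondVec (L : ℝ) (x y : Point) : Point :=
  x - y - (L * (round ((x 0 - y 0) / L) : ℝ)) • e₁

/-- The distance modulo `L`. -/
noncomputable def distMod (L : ℝ) (x y : Point) : ℝ := ‖bondVec L x y‖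

theorem bondVec_add_period (L : ℝ) (hL : L ≠ 0) (x y : Point) (t : ℤ) :
    bondVec L (x + (L * t : ℝ) • e₁) y = bondVec L x y := by
  have h : ((x + (L * t : ℝ) • e₁) 0 - y 0) / L = (x 0 - y 0) / L + t := by
    simp [e₁]
    field_simp
    ring
  unfold bondVec
  rw [h, round_add_intCast]
  push_cast
  module

theorem norm_add_axis_sq (v : Point) (s : ℝ) :
    ‖v + s • e₁‖ ^ 2 = (v 0 + s) ^ 2 + v 1 ^ 2 + v 2 ^ 2 := by
  rw [EuclideanSpace.norm_sq_eq]
  simp [Fin.sum_univ_three, e₁]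

theorem distMod_le (L : ℝ) (hL : 0 < L) (x y : Point) (t : ℤ) :
    distMod L x y ≤ ‖x - y + (L * t : ℝ) • e₁‖ := by
  unfold distMod bondVec
  rw [sub_eq_add_neg (x - y), ← neg_smul]
  refine (sq_le_sq₀ (norm_nonneg _) (norm_nonneg _)).mp ?_
  rw [norm_add_axis_sq, norm_add_axis_sq]
  have h := round_le ((x 0 - y 0) / L) (-t)
  have h2 : |x 0 - y 0 - L * round ((x 0 - y 0) / L)| ≤ |x 0 - y 0 + L * t| := by
    have e1 : x 0 - y 0 - L * round ((x 0 - y 0) / L)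
        = L * ((x 0 - y 0) / L - round ((x 0 - y 0) / L)) := by field_simp
    have e2 : x 0 - y 0 + L * t = L * ((x 0 - y 0) / L - ((-t : ℤ) : ℝ)) := by
      push_cast; field_simp; ring
    rw [e1, e2, abs_mul, abs_mul]
    exact mul_le_mul_of_nonneg_left h (abs_nonneg _)
  have h3 := sq_le_sq.mpr h2
  have h4 : (x - y) 0 = x 0 - y 0 := rfl
  rw [h4]
  linarith

/-- For points with axial coordinate in `[0, L)`, the distance modulo `L` is the minimum of
`|x - y + t L e₁|` over `t ∈ {-1, 0, 1}`. -/
theorem distMod_isLeast (L : ℝ) (x y : Point) (hx : x 0 ∈ Set.Ico 0 L)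
    (hy : y 0 ∈ Set.Ico 0 L) :
    IsLeast ((fun t : ℤ => ‖x - y + (L * t : ℝ) • e₁‖) '' {-1, 0, 1}) (distMod L x y) := by
  have hL : 0 < L := lt_of_le_of_lt hx.1 hx.2
  refine ⟨⟨-round ((x 0 - y 0) / L), ?_, ?_⟩, ?_⟩
  · have h1 : (x 0 - y 0) / L < 1 := by
      rw [div_lt_one hL]; linarith [hx.2, hy.1]
    have h2 : -1 < (x 0 - y 0) / L := by
      rw [lt_div_iff₀ hL]; linarith [hx.1, hy.2]
    have h3 := abs_le.mp (abs_sub_round ((x 0 - y 0) / L))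
    have h4 : ((round ((x 0 - y 0) / L) : ℤ) : ℝ) < ((2 : ℤ) : ℝ) := by push_cast; linarith [h3.1]
    have h5 : (((-2 : ℤ)) : ℝ) < ((round ((x 0 - y 0) / L) : ℤ) : ℝ) := by
      push_cast; linarith [h3.2]
    have h6 := Int.cast_lt.mp h4
    have h7 := Int.cast_lt.mp h5
    simp only [Set.mem_insert_iff, Set.mem_singleton_iff]
    omega
  · have h : x - y + (L * ((-round ((x 0 - y 0) / L) : ℤ) : ℝ)) • e₁ = bondVec L x y := by
      rw [bondVec, Int.cast_neg, mul_neg, neg_smul, ← sub_eq_add_neg]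
    exact congrArg norm h
  · rintro _ ⟨t, -, rfl⟩
    exact distMod_le L hL x y t

section Energy
open Classical in
/-- Ordered pairs of bonded atoms. -/
noncomputable def bonds {ι : Type} [Fintype ι] (C : Config ι) : Finset (ι × ι) :=
  Finset.univ.filter fun p => p.1 ≠ p.2 ∧ distMod C.period (C.pos p.1) (C.pos p.2) < 1.1

open Classical in
/-- Ordered triples `(i, j, k)` of atoms with `i`, `j` bonded, `j`, `k` bonded and `i ≠ k`. -/
noncomputable def triples {ι : Type} [Fintype ι] (C : Config ι) : Finset (ι × ι × ι) :=
  Finset.univ.filter fun t =>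
    t.1 ≠ t.2.2 ∧ (t.1, t.2.1) ∈ bonds C ∧ (t.2.1, t.2.2) ∈ bonds C

/-- The bond angle at atom `j` formed by the bonds to the atoms `i` and `k`. -/
noncomputable def bondAngle {ι : Type} (C : Config ι) (i j k : ι) : ℝ :=
  InnerProductGeometry.angle (bondVec C.period (C.pos i) (C.pos j))
    (bondVec C.period (C.pos k) (C.pos j))

/-- The configurational energy, the sum of two-body and three-body contributions. -/
noncomputable def energy (v₂ v₃ : ℝ → ℝ) {ι : Type} [Fintype ι] (C : Config ι) : ℝ :=
  1 / 2 * ∑ p ∈ bonds C, v₂ (distMod C.period (C.pos p.1) (C.pos p.2))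
    + 1 / 2 * ∑ t ∈ triples C, v₃ (bondAngle C t.1 t.2.1 t.2.2)
end Energy

/-- Admissible two-body potentials; only the values on `(0, ∞)` matter. -/
structure IsTwoBody (v₂ : ℝ → ℝ) : Prop where
  smooth : ContDiffOn ℝ ∞ v₂ (Set.Ioi 0)
  value_one : v₂ 1 = -1
  gt_of_ne_one : ∀ r, 0 < r → r ≠ 1 → -1 < v₂ r
  second_deriv_pos : 0 < iteratedDeriv 2 v₂ 1
  short_range : ∀ r, 1.1 ≤ r → v₂ r = 0

/-- Admissible three-body potentials; only the values on `[0, 2π]` matter. -/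
structure IsThreeBody (v₃ : ℝ → ℝ) : Prop where
  smooth : ContDiffOn ℝ ∞ v₃ (Set.Icc 0 (2 * π))
  nonneg : ∀ a ∈ Set.Icc 0 (2 * π), 0 ≤ v₃ a
  symm : ∀ a ∈ Set.Icc 0 (2 * π), v₃ a = v₃ (2 * π - a)
  eq_zero_iff : ∀ a ∈ Set.Icc 0 (2 * π), v₃ a = 0 ↔ a = 2 * π / 3 ∨ a = 4 * π / 3
  second_deriv_pos : 0 < iteratedDeriv 2 v₃ (2 * π / 3)

/-! ### Zigzag nanotubes -/

/-- Labels `(i, j, k, l)` of the atoms in one period consisting of `m` minimal periods; `i` runs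
through `0, …, ℓ - 1` (the label `i = ℓ` is the same as `i = 0`) and `j` through `0, …, m - 1`. -/
abbrev Label (ℓ m : ℕ) := Fin ℓ × Fin m × Fin 2 × Fin 2

/-- The atom with label `(i, j, k, l)` of the zigzag tube with parameters `lam₁`, `σ`, `ρ`. -/
noncomputable def atom (ℓ : ℕ) (lam₁ σ ρ : ℝ) (i j k l : ℕ) : Point :=
  !₂[k * (lam₁ + σ) + j * (2 * σ + 2 * lam₁) + l * (2 * σ + lam₁),
    ρ * cos (π * (2 * i + k) / ℓ), ρ * sin (π * (2 * i + k) / ℓ)]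

/-- The constraints on the parameters of the zigzag tubes with minimal period `μ`. -/
structure ZigzagParams (ℓ : ℕ) (μ lam₁ lam₂ σ ρ : ℝ) : Prop where
  lam₁_mem : lam₁ ∈ Set.Ioo 0 (μ / 2)
  lam₂_mem : lam₂ ∈ Set.Ioo 0 (μ / 2)
  σ_mem : σ ∈ Set.Ioo 0 (μ / 2)
  ρ_mem : ρ ∈ Set.Ioo 0 (μ / (4 * sin (π / (2 * ℓ))))
  period_eq : 2 * σ + 2 * lam₁ = μ
  bond_eq : σ ^ 2 + 4 * ρ ^ 2 * sin (π / (2 * ℓ)) ^ 2 = lam₂ ^ 2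

/-- The axial distance of neighbouring sections, as determined by `lam₁` and `μ`. -/
noncomputable def sigma (μ lam₁ : ℝ) : ℝ := μ / 2 - lam₁

/-- The radius of the tube, as determined by `lam₁`, `lam₂` and `μ`. -/
noncomputable def rho (ℓ : ℕ) (μ lam₁ lam₂ : ℝ) : ℝ :=
  √(lam₂ ^ 2 - sigma μ lam₁ ^ 2) / (2 * sin (π / (2 * ℓ)))

/-- For the bond lengths and minimal periods considered, `sigma` and `rho` are the only parameters
satisfying the constraints. -/
theorem zigzagParams_iff (ℓ : ℕ) (hℓ : 3 < ℓ) (μ lam₁ lam₂ σ ρ : ℝ)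
    (hμ : μ ∈ Set.Ioo 2.6 3.1) (h₁ : lam₁ ∈ Set.Ioo 0.9 1.1) (h₂ : lam₂ ∈ Set.Ioo 0.9 1.1) :
    ZigzagParams ℓ μ lam₁ lam₂ σ ρ ↔ σ = sigma μ lam₁ ∧ ρ = rho ℓ μ lam₁ lam₂ := by
  obtain ⟨hμ1, hμ2⟩ := hμ
  obtain ⟨h11, h12⟩ := h₁
  obtain ⟨h21, h22⟩ := h₂
  norm_num at hμ1 hμ2 h11 h12 h21 h22
  have hℓ' : (3 : ℝ) < ℓ := by exact_mod_cast hℓ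
  have hs : 0 < sin (π / (2 * ℓ)) := by
    apply sin_pos_of_pos_of_lt_pi
    · have := pi_pos; positivity
    · apply div_lt_self pi_pos; linarith
  have hpos : 0 < lam₂ ^ 2 - sigma μ lam₁ ^ 2 := by unfold sigma; nlinarith
  have hsq := Real.sq_sqrt hpos.le
  have hsp := Real.sqrt_pos.mpr hpos
  constructor
  · intro h
    have hσ : σ = sigma μ lam₁ := by have := h.period_eq; unfold sigma; linarith
    refine ⟨hσ, ?_⟩
    have hb := h.bond_eq
    have hρ := h.ρ_mem.1
    unfold rho
    rw [eq_div_iff (by positivity), ← Real.sqrt_sq (by positivity : 0 ≤ ρ * (2 * sin (π / (2 * ℓ))))]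
    congr 1
    rw [← hσ]; linarith
  · rintro ⟨rfl, rfl⟩
    have hmul : rho ℓ μ lam₁ lam₂ * (2 * sin (π / (2 * ℓ))) = √(lam₂ ^ 2 - sigma μ lam₁ ^ 2) := by
      unfold rho; field_simp
    refine ⟨⟨by linarith, by linarith⟩, ⟨by linarith, by linarith⟩,
      ⟨by unfold sigma; linarith, by unfold sigma; linarith⟩, ⟨by unfold rho; positivity, ?_⟩,
      by unfold sigma; ring, ?_⟩
    · rw [lt_div_iff₀ (by positivity)]
      have : √(lam₂ ^ 2 - sigma μ lam₁ ^ 2) < μ / 2 := by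
        rw [Real.sqrt_lt' (by linarith)]; nlinarith [sq_nonneg (sigma μ lam₁)]
      linarith
    · have : 4 * rho ℓ μ lam₁ lam₂ ^ 2 * sin (π / (2 * ℓ)) ^ 2
          = (rho ℓ μ lam₁ lam₂ * (2 * sin (π / (2 * ℓ)))) ^ 2 := by ring
      rw [this, hmul, hsq]; ring

/-- The zigzag tube with bond lengths `lam₁`, `lam₂` and minimal period `μ`, seen as a
configuration with period `m μ` and `4 m ℓ` atoms per period. -/
noncomputable def tube (ℓ m : ℕ) (lam₁ lam₂ μ : ℝ) : Config (Label ℓ m) where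
  pos := fun a => atom ℓ lam₁ (sigma μ lam₁) (rho ℓ μ lam₁ lam₂) a.1 a.2.1 a.2.2.1 a.2.2.2
  period := m * μ

/-! ### Unstretched tubes -/

/-- The interior angle of a regular `2ℓ`-gon. -/
noncomputable def gam (ℓ : ℕ) : ℝ := π * (1 - 1 / ℓ)

/-- The third bond angle as a function of the other one and of the kink angle. -/
noncomputable def beta (a g : ℝ) : ℝ := 2 * arcsin (sin a * sin (g / 2))

/-- `a` is the angle for which all bond angles of the tube with unit bonds coincide. -/
def IsEqualAngle (ℓ : ℕ) (a : ℝ) : Prop :=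
  a ∈ Set.Ioo (arccos (-0.4)) (arccos (-0.6)) ∧ beta a (gam ℓ) = a ∧
    ∀ a' ∈ Set.Ioo (arccos (-0.4)) (arccos (-0.6)), beta a' (gam ℓ) = a' → a' = a

/-- The minimal period of the tube with unit bond lengths and bond angle `a`. -/
noncomputable def periodOfAngle (a : ℝ) : ℝ := 2 - 2 * cos a

/-- `a` is the bond angle of the unstretched tube: among the tubes with unit bond lengths and bond
angle in `A` it is the only one of least energy, and
`a ∈ (a_ch, 2π/3) ⊆ A` where `a_ch` is the angle for which all bond angles coincide. -/
def IsUnstretchedAngle (v₂ v₃ : ℝ → ℝ) (ℓ : ℕ) (A : Set ℝ) (a : ℝ) : Prop :=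
  (∀ m : ℕ, 0 < m → ∀ a' ∈ A, a' ≠ a →
    energy v₂ v₃ (tube ℓ m 1 1 (periodOfAngle a)) <
      energy v₂ v₃ (tube ℓ m 1 1 (periodOfAngle a'))) ∧
  ∃ a_ch, IsEqualAngle ℓ a_ch ∧ a ∈ Set.Ioo a_ch (2 * π / 3) ∧ Set.Ioo a_ch (2 * π / 3) ⊆ A

/-- The unstretched angle does not depend on the choice of `A`. -/
theorem IsUnstretchedAngle.unique {v₂ v₃ : ℝ → ℝ} {ℓ : ℕ} {A A' : Set ℝ} {a a' : ℝ}
    (h : IsUnstretchedAngle v₂ v₃ ℓ A a) (h' : IsUnstretchedAngle v₂ v₃ ℓ A' a') : a = a' := by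
  obtain ⟨h1, b, hb, hab, hbA⟩ := h
  obtain ⟨h1', b', hb', hab', hbA'⟩ := h'
  obtain rfl : b' = b := hb.2.2 b' hb'.1 hb'.2.1
  by_contra hne
  exact lt_asymm (h1 1 one_pos a' (hbA hab') (Ne.symm hne)) (h1' 1 one_pos a (hbA' hab) hne)

/-! ### Stretched and cleaved tubes -/

/-- The bond lengths `lam` minimize the energy among the zigzag tubes with minimal period `μ` and
bond lengths in `(0.9, 1.1)`. -/
def IsMinimizer (v₂ v₃ : ℝ → ℝ) (ℓ m : ℕ) (μ : ℝ) (lam : ℝ × ℝ) : Prop :=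
  lam.1 ∈ Set.Ioo 0.9 1.1 ∧ lam.2 ∈ Set.Ioo 0.9 1.1 ∧
    ∀ lam' : ℝ × ℝ, lam'.1 ∈ Set.Ioo 0.9 1.1 → lam'.2 ∈ Set.Ioo 0.9 1.1 →
      energy v₂ v₃ (tube ℓ m lam.1 lam.2 μ) ≤ energy v₂ v₃ (tube ℓ m lam'.1 lam'.2 μ)

/-- The cleaved tube with period `m μ`: the atoms with `j < m / 2` are those of the tube with unit
bond lengths and minimal period `μus`, the ones with `m / 2 ≤ j < m` are those translated by
`m (μ - μus)` along the axis. -/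
noncomputable def cleaved (ℓ m : ℕ) (μus μ : ℝ) : Config (Label ℓ m) where
  pos := fun a =>
    if ((a.2.1 : ℕ) : ℝ) < (m : ℝ) / 2 then (tube ℓ m 1 1 μus).pos a
    else (tube ℓ m 1 1 μus).pos a + (m * (μ - μus)) • e₁
  period := m * μ

end Nanotube

open scoped Topology

namespace Nanotube

/-! ### One-dimensional wells -/

/-! Every atom of a zigzag tube has one axial bond of length λ₁ and two zigzag bonds of length λ₂.
With t = σ/λ₂ and ε = 1 - cos(π/ℓ), two of its angles have cosine -t and the third has cosine 2t² -
1 + ε(1 - t²). Hence the energy is 4mℓ times `atomEnergy`, that is ½v₂(λ₁) + v₂(λ₂) + `angPot`(t)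
(`energy_tube`), and everything about intact tubes becomes calculus in two variables.

For small ε, `angPot` has a nondegenerate minimum t₀ between (1-ε)/(2-ε), where all three cosines
agree, and 1/2 (`IsWell.exists_unstretched`). Since μ = 2λ₁ + 2tλ₂, an extension of the period must
be paid for by λ₁, λ₂ or t, so the excess energy per atom is at least κ(μ - μus)² with κ independent
of ℓ (`atomEnergy_growth`). Uniqueness of the optimal bond lengths near μus follows from a midpoint
comparison: the two-body part is uniformly convex, and the failure of t to be affine in (λ₁, λ₂) is
harmless because `angPot` is nearly stationary at t₀ (`atomEnergy_midpoint_lt`).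

Cleaving destroys only bonds at a single cut. The upper half is shifted by exactly the added period,
so the bonds through the end of the period survive, and all surviving bonds keep their vectors. At
most 24ℓ ordered pairs are lost, costing at most 12ℓ in energy (`energy_cleaved_le`). If m(μ - μus)²
≥ c² with κc² > 3, the intact tube has excess greater than 4ℓ·3 = 12ℓ, and fracture is cheaper. -/

theorem convexOn_sub_sq {a b k : ℝ} {f f' f'' : ℝ → ℝ}
    (h1 : ∀ x ∈ Set.Ioo a b, HasDerivAt f (f' x) x)
    (h2 : ∀ x ∈ Set.Ioo a b, HasDerivAt f' (f'' x) x)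
    (h3 : ∀ x ∈ Set.Ioo a b, k ≤ f'' x) (z : ℝ) :
    ConvexOn ℝ (Set.Ioo a b) fun x => f x - k / 2 * (x - z) ^ 2 := by
  have d1 : ∀ x ∈ Set.Ioo a b,
      HasDerivAt (fun x => f x - k / 2 * (x - z) ^ 2) (f' x - k * (x - z)) x := by
    intro x hx
    refine ((h1 x hx).sub ((((hasDerivAt_id x).sub_const z).pow 2).const_mul (k / 2))).congr_deriv ?_
    simp
    ring
  have d2 : ∀ x ∈ Set.Ioo a b, HasDerivAt (fun x => f' x - k * (x - z)) (f'' x - k) x := by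
    intro x hx
    refine ((h2 x hx).sub (((hasDerivAt_id x).sub_const z).const_mul k)).congr_deriv ?_
    simp
  refine convexOn_of_hasDerivWithinAt2_nonneg (f' := fun x => f' x - k * (x - z))
    (f'' := fun x => f'' x - k) (convex_Ioo a b)
    (fun x hx => (d1 x hx).continuousAt.continuousWithinAt) ?_ ?_ ?_ <;> rw [interior_Ioo]
  · exact fun x hx => (d1 x hx).hasDerivWithinAt
  · exact fun x hx => (d2 x hx).hasDerivWithinAt
  · exact fun x hx => sub_nonneg.2 (h3 x hx)

/-- Subtracting the parabola centred at x₀ preserves both convexity and the critical point, and a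
convex function is minimal at a critical point. -/
theorem quadratic_growth_of_critical {a b k x₀ : ℝ} {f f' f'' : ℝ → ℝ}
    (h1 : ∀ x ∈ Set.Ioo a b, HasDerivAt f (f' x) x)
    (h2 : ∀ x ∈ Set.Ioo a b, HasDerivAt f' (f'' x) x)
    (h3 : ∀ x ∈ Set.Ioo a b, k ≤ f'' x) (hx₀ : x₀ ∈ Set.Ioo a b) (h0 : f' x₀ = 0)
    {x : ℝ} (hx : x ∈ Set.Ioo a b) : k / 2 * (x - x₀) ^ 2 ≤ f x - f x₀ := by
  have hc := convexOn_sub_sq h1 h2 h3 x₀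
  have hd : HasDerivAt (fun x => f x - k / 2 * (x - x₀) ^ 2) 0 x₀ := by
    refine ((h1 x₀ hx₀).sub
      ((((hasDerivAt_id x₀).sub_const x₀).pow 2).const_mul (k / 2))).congr_deriv ?_
    simp [h0]
  have hloc : IsMinOn (fun x => f x - k / 2 * (x - x₀) ^ 2) (Set.Ioo a b) x₀ := by
    intro y hy
    rcases lt_trichotomy x₀ y with hlt | rfl | hlt
    · have h := hc.le_slope_of_hasDerivAt hx₀ hy hlt hd
      rw [slope_def_field, le_div_iff₀ (sub_pos.2 hlt), zero_mul] at h
      exact sub_nonneg.1 h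
    · exact le_refl (f x₀ - k / 2 * (x₀ - x₀) ^ 2)
    · have h := hc.slope_le_of_hasDerivAt hy hx₀ hlt hd
      rw [slope_def_field, div_le_iff₀ (sub_pos.2 hlt), zero_mul] at h
      exact sub_nonpos.1 h
  have h : f x₀ - k / 2 * (x₀ - x₀) ^ 2 ≤ f x - k / 2 * (x - x₀) ^ 2 := hloc hx
  rw [sub_self] at h
  linarith

/-- Midpoint convexity of f minus a parabola, together with x² + y² - 2((x+y)/2)² = (x-y)²/2; this
turns k/2 into k/4. -/
theorem midpoint_gap {a b k : ℝ} {f f' f'' : ℝ → ℝ}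
    (h1 : ∀ x ∈ Set.Ioo a b, HasDerivAt f (f' x) x)
    (h2 : ∀ x ∈ Set.Ioo a b, HasDerivAt f' (f'' x) x)
    (h3 : ∀ x ∈ Set.Ioo a b, k ≤ f'' x) {x y : ℝ} (hx : x ∈ Set.Ioo a b)
    (hy : y ∈ Set.Ioo a b) : k / 4 * (x - y) ^ 2 ≤ f x + f y - 2 * f ((x + y) / 2) := by
  have hc := (convexOn_sub_sq h1 h2 h3 0).2 hx hy (by norm_num : (0 : ℝ) ≤ 1 / 2)
    (by norm_num : (0 : ℝ) ≤ 1 / 2) (by norm_num)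
  have he : (1 / 2 : ℝ) • x + (1 / 2 : ℝ) • y = (x + y) / 2 := by simp only [smul_eq_mul]; ring
  rw [he] at hc
  simp only [smul_eq_mul] at hc
  nlinarith

theorem _root_.ContDiffAt.deriv_of_add_one_le {f : ℝ → ℝ} {x : ℝ} {n m : WithTop ℕ∞}
    (hf : ContDiffAt ℝ n f x) (hmn : m + 1 ≤ n) : ContDiffAt ℝ m (deriv f) x :=
  (hf.fderiv_right hmn).clm_apply contDiffAt_const

/-- The bound on the first derivative serves to absorb the term in which it multiplies the second
derivative of an inner function, when a composition with h is shown to be convex. -/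
theorem exists_well_nbhd {h : ℝ → ℝ} {x₀ : ℝ} (hs : ContDiffAt ℝ 2 h x₀)
    (h1 : deriv h x₀ = 0) (h2 : 0 < deriv (deriv h) x₀) :
    ∃ k > 0, ∃ r > 0, ∀ x ∈ Set.Ioo (x₀ - r) (x₀ + r),
      HasDerivAt h (deriv h x) x ∧ HasDerivAt (deriv h) (deriv (deriv h) x) x ∧
        k ≤ deriv (deriv h) x ∧ |deriv h x| ≤ k / 4 := by
  have hs1 := hs.deriv_of_add_one_le (m := 1) (by norm_num)
  have hs0 := hs1.deriv_of_add_one_le (m := 0) (by norm_num)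
  have e1 : ∀ᶠ x in 𝓝 x₀, ContDiffAt ℝ 2 h x := hs.eventually (by simp)
  have e2 : ∀ᶠ x in 𝓝 x₀, deriv (deriv h) x₀ / 2 < deriv (deriv h) x :=
    hs0.continuousAt.eventually (lt_mem_nhds (by linarith))
  have e3 : ∀ᶠ x in 𝓝 x₀, |deriv h x| < deriv (deriv h) x₀ / 2 / 4 :=
    hs1.continuousAt.abs.eventually (gt_mem_nhds (by simp only [h1, abs_zero]; positivity))
  obtain ⟨r, hr, hball⟩ := Metric.eventually_nhds_iff_ball.1 (e1.and (e2.and e3))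
  rw [Real.ball_eq_Ioo] at hball
  refine ⟨deriv (deriv h) x₀ / 2, by positivity, r, hr, fun x hx => ?_⟩
  obtain ⟨q1, q2, q3⟩ := hball x hx
  exact ⟨(q1.differentiableAt (by simp)).hasDerivAt,
    ((q1.deriv_of_add_one_le (m := 1) (by norm_num)).differentiableAt (by simp)).hasDerivAt,
    q2.le, q3.le⟩

/-- Outside the neighbourhood of x₀, compactness gives h - h(x₀) a positive minimum, while (x - x₀)²
is bounded there; the ratio is an admissible constant. -/
theorem exists_quadratic_growth {h : ℝ → ℝ} {a b x₀ k r : ℝ} (hc : ContinuousOn h (Set.Icc a b))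
    (hk : 0 < k) (hr : 0 < r) (hmin : ∀ x ∈ Set.Icc a b, x ≠ x₀ → h x₀ < h x)
    (hloc : ∀ x ∈ Set.Ioo (x₀ - r) (x₀ + r), k * (x - x₀) ^ 2 ≤ h x - h x₀) :
    ∃ c > 0, ∀ x ∈ Set.Icc a b, c * (x - x₀) ^ 2 ≤ h x - h x₀ := by
  obtain ⟨R, hR⟩ : ∃ R : ℝ, ∀ x ∈ Set.Icc a b, (x - x₀) ^ 2 ≤ R := by
    obtain ⟨R, hR⟩ := isCompact_Icc.bddAbove_image
      (f := fun x : ℝ => (x - x₀) ^ 2) (K := Set.Icc a b) (by fun_prop)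
    exact ⟨R, fun x hx => hR (Set.mem_image_of_mem _ hx)⟩
  have hcomp : IsCompact (Set.Icc a b \ Set.Ioo (x₀ - r) (x₀ + r)) :=
    isCompact_Icc.diff isOpen_Ioo
  rcases Set.eq_empty_or_nonempty (Set.Icc a b \ Set.Ioo (x₀ - r) (x₀ + r)) with he | hne
  · exact ⟨k, hk, fun x hx => hloc x (Set.sdiff_eq_empty.1 he hx)⟩
  obtain ⟨z, hz, hzm⟩ := hcomp.exists_isMinOn hne (hc.mono Set.sdiff_subset)
  have hzne : z ≠ x₀ := by
    rintro rfl
    exact hz.2 ⟨by linarith, by linarith⟩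
  have hpos : 0 < h z - h x₀ := sub_pos.2 (hmin z hz.1 hzne)
  have hRp : 0 < R := lt_of_lt_of_le (pow_pos (abs_pos.2 (sub_ne_zero.2 hzne)) 2)
    (by rw [sq_abs]; exact hR z hz.1)
  refine ⟨min k ((h z - h x₀) / R), lt_min hk (by positivity), fun x hx => ?_⟩
  by_cases hxr : x ∈ Set.Ioo (x₀ - r) (x₀ + r)
  · exact (mul_le_mul_of_nonneg_right (min_le_left _ _) (sq_nonneg _)).trans (hloc x hxr)
  · have h1 : h z ≤ h x := hzm ⟨hx, hxr⟩
    calc _ ≤ (h z - h x₀) / R * R := by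
          gcongr
          · exact min_le_right _ _
          · exact hR x hx
      _ = h z - h x₀ := by field_simp
      _ ≤ _ := by linarith

theorem IsTwoBody.contDiffAt {v₂ : ℝ → ℝ} (h : IsTwoBody v₂) {r : ℝ} (hr : 0 < r) :
    ContDiffAt ℝ 2 v₂ r :=
  (h.smooth.contDiffAt (Ioi_mem_nhds hr)).of_le (by norm_cast)

theorem IsTwoBody.neg_one_le {v₂ : ℝ → ℝ} (h : IsTwoBody v₂) {r : ℝ} (hr : 0 < r) :
    -1 ≤ v₂ r := by
  by_cases h1 : r = 1
  · rw [h1, h.value_one]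
  · exact (h.gt_of_ne_one r hr h1).le

theorem IsTwoBody.exists_well {v₂ : ℝ → ℝ} (h : IsTwoBody v₂) :
    ∃ k > 0, ∃ r > 0, (∀ x ∈ Set.Icc 0.9 1.1, k * (x - 1) ^ 2 ≤ v₂ x + 1) ∧
      ∀ x ∈ Set.Ioo (1 - r) (1 + r), ∀ y ∈ Set.Ioo (1 - r) (1 + r),
        k * (x - y) ^ 2 ≤ v₂ x + v₂ y - 2 * v₂ ((x + y) / 2) := by
  have hmin : IsLocalMin v₂ 1 := by
    filter_upwards [Ioi_mem_nhds one_pos] with x hx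
    rw [h.value_one]
    exact h.neg_one_le hx
  have h2 := h.second_deriv_pos
  rw [iteratedDeriv_succ, iteratedDeriv_one] at h2
  obtain ⟨k, hk, r, hr, H⟩ := exists_well_nbhd (h.contDiffAt one_pos) hmin.deriv_eq_zero h2
  have H1 := fun x hx => (H x hx).1
  have H2 := fun x hx => (H x hx).2.1
  have H3 := fun x hx => (H x hx).2.2.1
  obtain ⟨c, hc, hcg⟩ := exists_quadratic_growth (h := v₂) (a := 0.9) (b := 1.1) (x₀ := 1)
    (k := k / 2) (r := r)
    (fun x hx => (h.contDiffAt (lt_of_lt_of_le (by norm_num) hx.1)).continuousAt.continuousWithinAt)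
    (by positivity) hr
    (fun x hx hne => by
      rw [h.value_one]; exact h.gt_of_ne_one x (lt_of_lt_of_le (by norm_num) hx.1) hne)
    (fun x hx => quadratic_growth_of_critical H1 H2 H3 ⟨by linarith, by linarith⟩
      hmin.deriv_eq_zero hx)
  refine ⟨min c (k / 4), by positivity, r, hr, fun x hx => ?_, fun x hx y hy => ?_⟩
  · have := hcg x hx
    rw [h.value_one, sub_neg_eq_add] at this
    exact (mul_le_mul_of_nonneg_right (min_le_left _ _) (sq_nonneg _)).trans this
  · exact (mul_le_mul_of_nonneg_right (min_le_right _ _) (sq_nonneg _)).trans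
      (midpoint_gap H1 H2 H3 hx hy)

/-! ### The angular potential -/

/-- A potential in the cosine of the bond angle with a nondegenerate minimum at `-1 / 2`. -/
structure IsWell (g : ℝ → ℝ) : Prop where
  cont : ContinuousOn g (Set.Icc (-1) 1)
  smooth : ∀ x ∈ Set.Ioo (-1 : ℝ) 1, ContDiffAt ℝ 2 g x
  zero : g (-1 / 2) = 0
  pos : ∀ x ∈ Set.Icc (-1 : ℝ) 1, x ≠ -1 / 2 → 0 < g x
  second : 0 < deriv (deriv g) (-1 / 2)

theorem IsWell.nonneg {g : ℝ → ℝ} (hg : IsWell g) {x : ℝ} (hx : x ∈ Set.Icc (-1 : ℝ) 1) :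
    0 ≤ g x := by
  by_cases h : x = -1 / 2
  · rw [h, hg.zero]
  · exact (hg.pos x hx h).le

theorem IsWell.deriv_eq_zero {g : ℝ → ℝ} (hg : IsWell g) : deriv g (-1 / 2) = 0 := by
  apply IsLocalMin.deriv_eq_zero
  filter_upwards [Icc_mem_nhds (by norm_num : (-1 : ℝ) < -1 / 2) (by norm_num : (-1 / 2 : ℝ) < 1)]
    with x hx
  rw [hg.zero]
  exact hg.nonneg hx

theorem arccos_neg_half : arccos (-1 / 2) = 2 * π / 3 := by
  rw [show (-1 / 2 : ℝ) = -cos (π / 3) by rw [cos_pi_div_three]; norm_num,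
    ← cos_pi_sub, arccos_cos (by linarith [pi_pos]) (by linarith [pi_pos])]
  ring

/-- The zero 4π/3 is out of the range of `arccos`, so one zero remains. Since v₃' vanishes at 2π/3,
the second derivative of the composition there is v₃'' times the square of the nonzero derivative of
`arccos`. -/
theorem IsThreeBody.isWell {v₃ : ℝ → ℝ} (h : IsThreeBody v₃) :
    IsWell fun x => v₃ (arccos x) := by
  have hmem : ∀ x, arccos x ∈ Set.Icc 0 (2 * π) := fun x =>
    ⟨arccos_nonneg x, by linarith [arccos_le_pi x, pi_pos]⟩
  have hsm : ∀ a ∈ Set.Ioo 0 (2 * π), ContDiffAt ℝ 2 v₃ a := fun a ha =>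
    (h.smooth.contDiffAt (Icc_mem_nhds ha.1 ha.2)).of_le (by norm_cast)
  have hin : ∀ x ∈ Set.Ioo (-1 : ℝ) 1, arccos x ∈ Set.Ioo 0 (2 * π) := fun x hx =>
    ⟨arccos_pos.2 hx.2, by linarith [arccos_le_pi x, pi_pos]⟩
  have hd : ∀ x ∈ Set.Ioo (-1 : ℝ) 1,
      HasDerivAt (fun x => v₃ (arccos x)) (deriv v₃ (arccos x) * -(1 / √(1 - x ^ 2))) x :=
    fun x hx => ((hsm _ (hin x hx)).differentiableAt (by simp)).hasDerivAt.comp x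
      (hasDerivAt_arccos hx.1.ne' hx.2.ne)
  have hm : (-1 / 2 : ℝ) ∈ Set.Ioo (-1 : ℝ) 1 := by constructor <;> norm_num
  refine ⟨h.smooth.continuousOn.comp continuous_arccos.continuousOn fun x _ => hmem x,
    fun x hx => (hsm _ (hin x hx)).comp x (contDiffAt_arccos hx.1.ne' hx.2.ne), ?_, ?_, ?_⟩
  · rw [h.eq_zero_iff _ (hmem _), arccos_neg_half]
    exact Or.inl rfl
  · intro x hx hne
    refine lt_of_le_of_ne (h.nonneg _ (hmem x)) fun h0 => ?_
    rcases (h.eq_zero_iff _ (hmem x)).1 h0.symm with h1 | h1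
    · rw [← arccos_neg_half] at h1
      exact hne (arccos_injOn hx ⟨by norm_num, by norm_num⟩ h1)
    · linarith [arccos_le_pi x, pi_pos]
  · have h2 := h.second_deriv_pos
    rw [iteratedDeriv_succ, iteratedDeriv_one, ← arccos_neg_half] at h2
    have h1 : deriv v₃ (arccos (-1 / 2)) = 0 := by
      apply IsLocalMin.deriv_eq_zero
      filter_upwards [Icc_mem_nhds (hin _ hm).1 (hin _ hm).2] with x hx
      rw [(h.eq_zero_iff _ (hmem _)).2 (Or.inl arccos_neg_half)]
      exact h.nonneg x hx
    have hs1 := (hsm _ (hin _ hm)).deriv_of_add_one_le (m := 1) (by norm_num)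
    have hk : DifferentiableAt ℝ (fun x : ℝ => -(1 / √(1 - x ^ 2))) (-1 / 2) := by
      refine (DifferentiableAt.div (differentiableAt_const _) (DifferentiableAt.sqrt (by fun_prop)
        (by norm_num)) ?_).neg
      exact (Real.sqrt_pos.2 (by norm_num)).ne'
    have hdd := ((hs1.differentiableAt (by simp)).hasDerivAt.comp (-1 / 2 : ℝ)
      (hasDerivAt_arccos hm.1.ne' hm.2.ne)).mul hk.hasDerivAt
    have heq : deriv (fun x => v₃ (arccos x)) =ᶠ[𝓝 (-1 / 2)]
        fun x => deriv v₃ (arccos x) * -(1 / √(1 - x ^ 2)) := by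
      filter_upwards [Ioo_mem_nhds hm.1 hm.2] with x hx
      exact (hd x hx).deriv
    rw [heq.deriv_eq]
    have hval := hdd.deriv
    simp only [Function.comp_apply, h1, zero_mul, add_zero] at hval
    have hs : 0 < √(1 - (-1 / 2 : ℝ) ^ 2) := Real.sqrt_pos.2 (by norm_num)
    refine lt_of_lt_of_eq ?_ hval.symm
    rw [mul_assoc, neg_mul_neg]
    positivity

/-- The energy of the three angles at an atom, where `-t` is the cosine of the angles formed with
the axial bond and `ε = 1 - cos (π / ℓ)` measures the curvature of the tube. -/
noncomputable def angPot (g : ℝ → ℝ) (ε t : ℝ) : ℝ :=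
  2 * g (-t) + g (2 * t ^ 2 - 1 + ε * (1 - t ^ 2))

theorem IsWell.angPot_continuousOn {g : ℝ → ℝ} (hg : IsWell g) {ε : ℝ} (h0 : 0 ≤ ε) (h1 : ε ≤ 1) :
    ContinuousOn (angPot g ε) (Set.Icc 0 1) := by
  unfold angPot
  refine ((hg.cont.comp (by fun_prop) fun t ht => ?_).const_mul 2).add
    (hg.cont.comp (by fun_prop) fun t ht => ?_)
  · exact ⟨by linarith [ht.2], by linarith [ht.1]⟩
  · obtain ⟨ht0, ht1⟩ := ht
    constructor <;> nlinarith [mul_nonneg h0 (by nlinarith : 0 ≤ 1 - t ^ 2),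
      mul_nonneg (sub_nonneg.2 h1) (by nlinarith : 0 ≤ 1 - t ^ 2)]

theorem IsWell.angPot_nonneg {g : ℝ → ℝ} (hg : IsWell g) {ε t : ℝ} (h0 : 0 ≤ ε) (h1 : ε ≤ 1)
    (ht : t ∈ Set.Icc (0 : ℝ) 1) : 2 * g (-t) ≤ angPot g ε t := by
  obtain ⟨ht0, ht1⟩ := ht
  have : 0 ≤ g (2 * t ^ 2 - 1 + ε * (1 - t ^ 2)) := by
    apply hg.nonneg
    constructor <;> nlinarith [mul_nonneg h0 (by nlinarith : 0 ≤ 1 - t ^ 2),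
      mul_nonneg (sub_nonneg.2 h1) (by nlinarith : 0 ≤ 1 - t ^ 2)]
  unfold angPot
  linarith

/-- Near 1/2 convexity makes the critical point t₀ a quadratic minimum. Far from 1/2 the terms
2g(-t) alone exceed the minimal value, which tends to 0 with ε. The constants δ, ε₀ and c are fixed
before ε, hence do not depend on ℓ. -/
theorem IsWell.exists_unstretched {g : ℝ → ℝ} (hg : IsWell g) :
    ∃ δ > 0, δ ≤ 0.05 ∧ ∃ ε₀ > 0, ε₀ ≤ 0.1 ∧ ∃ c > 0, ∀ ε, 0 < ε → ε < ε₀ →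
      ∃ t₀ ∈ Set.Ioo ((1 - ε) / (2 - ε)) (1 / 2), 1 / 2 - δ < (1 - ε) / (2 - ε) ∧
        (∀ t ∈ Set.Icc (0 : ℝ) 1, c * (t - t₀) ^ 2 ≤ angPot g ε t - angPot g ε t₀) ∧
        ConvexOn ℝ (Set.Ioo (1 / 2 - δ) (1 / 2 + δ)) (angPot g ε) ∧
        HasStrictDerivAt (angPot g ε) 0 t₀ := by
  have hm : (-1 / 2 : ℝ) ∈ Set.Ioo (-1 : ℝ) 1 := by constructor <;> norm_num
  obtain ⟨k, hk, r', hr', H'⟩ := exists_well_nbhd (hg.smooth _ hm) hg.deriv_eq_zero hg.second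
  obtain ⟨r, hr, hr1, H⟩ : ∃ r > 0, r ≤ 0.2 ∧ ∀ x ∈ Set.Ioo (-1 / 2 - r) (-1 / 2 + r),
      HasDerivAt g (deriv g x) x ∧ HasDerivAt (deriv g) (deriv (deriv g) x) x ∧
        k ≤ deriv (deriv g) x ∧ |deriv g x| ≤ k / 4 := by
    refine ⟨min r' 0.2, by positivity, min_le_right _ _, fun x hx => H' x ?_⟩
    have := min_le_left r' 0.2
    exact ⟨by linarith [hx.1], by linarith [hx.2]⟩
  have hmr : (-1 / 2 : ℝ) ∈ Set.Ioo (-1 / 2 - r) (-1 / 2 + r) := ⟨by linarith, by linarith⟩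
  obtain ⟨c₀, hc₀, hgrow⟩ := exists_quadratic_growth (h := g) (x₀ := -1 / 2) hg.cont
    (half_pos hk) hr (fun x hx hne => by rw [hg.zero]; exact hg.pos x hx hne)
    (fun x hx => quadratic_growth_of_critical (fun x hx => (H x hx).1) (fun x hx => (H x hx).2.1)
      (fun x hx => (H x hx).2.2.1) hmr hg.deriv_eq_zero hx)
  have hpos : ∀ x, -1 / 2 < x → x < -1 / 2 + r → 0 < deriv g x := by
    intro x hx1 hx2
    have hmono : StrictMonoOn (deriv g) (Set.Ioo (-1 / 2 - r) (-1 / 2 + r)) := by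
      refine strictMonoOn_of_deriv_pos (convex_Ioo _ _)
        (fun x hx => (H x hx).2.1.continuousAt.continuousWithinAt) fun x hx => ?_
      rw [interior_Ioo] at hx
      exact hk.trans_le (H x hx).2.2.1
    have := hmono hmr ⟨by linarith, hx2⟩ hx1
    rwa [hg.deriv_eq_zero] at this
  obtain ⟨δ, hδ, hδ1, hδr⟩ : ∃ δ > 0, δ ≤ 0.05 ∧ δ ≤ r / 4 :=
    ⟨min 0.05 (r / 4), by positivity, min_le_left _ _, min_le_right _ _⟩
  -- The value at t = 1/2 is g(-1/2 + 3ε/4), an upper bound for the minimum. It is kept below c₀δ²,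
  -- half of the lower bound 2c₀δ² available when |t - 1/2| ≥ δ.
  obtain ⟨ε₁, hε₁, hsmall⟩ : ∃ ε₁ > 0, ∀ ε, 0 < ε → ε < ε₁ →
      g (-1 / 2 + 3 / 4 * ε) < c₀ * δ ^ 2 := by
    have hcont : ContinuousAt (fun ε : ℝ => g (-1 / 2 + 3 / 4 * ε)) 0 := by
      apply ContinuousAt.comp (f := fun ε : ℝ => -1 / 2 + 3 / 4 * ε)
      · show ContinuousAt g (-1 / 2 + 3 / 4 * 0)
        rw [mul_zero, add_zero]
        exact (hg.smooth _ hm).continuousAt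
      · fun_prop
    have hev := hcont.tendsto.eventually_lt_const
      (by rw [mul_zero, add_zero, hg.zero]; positivity : _ < c₀ * δ ^ 2)
    obtain ⟨ε₁, hε₁, hb⟩ := Metric.eventually_nhds_iff_ball.1 hev
    rw [Real.ball_eq_Ioo] at hb
    exact ⟨ε₁, hε₁, fun ε h0 h1 => hb ε ⟨by linarith, by linarith⟩⟩
  refine ⟨δ, hδ, hδ1, min (min 0.1 δ) (min (r / 4) ε₁), by positivity,
    (min_le_left _ _).trans (min_le_left _ _), min (k / 2) (c₀ * δ ^ 2), by positivity, ?_⟩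
  intro ε hε hlt
  obtain ⟨⟨hε01, hεδ⟩, hεr, hεε₁⟩ : (ε < 0.1 ∧ ε < δ) ∧ ε < r / 4 ∧ ε < ε₁ := by
    simpa only [lt_min_iff] using hlt
  norm_num at hδ1 hε01 hr1
  set y : ℝ → ℝ := fun t => 2 * t ^ 2 - 1 + ε * (1 - t ^ 2) with hy
  have hneg : ∀ t ∈ Set.Ioo (1 / 2 - δ) (1 / 2 + δ), -t ∈ Set.Ioo (-1 / 2 - r) (-1 / 2 + r) :=
    fun t ht => ⟨by linarith [ht.2], by linarith [ht.1]⟩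
  have hyr : ∀ t ∈ Set.Ioo (1 / 2 - δ) (1 / 2 + δ), y t ∈ Set.Ioo (-1 / 2 - r) (-1 / 2 + r) := by
    rintro t ⟨ht1, ht2⟩
    have e1 : 0 ≤ ε * (1 - t ^ 2) := mul_nonneg hε.le (by nlinarith)
    have e2 : ε * (1 - t ^ 2) ≤ ε := by nlinarith [sq_nonneg t, mul_nonneg hε.le (sq_nonneg t)]
    constructor <;> simp only [hy] <;> nlinarith
  have hdy : ∀ t, HasDerivAt y (2 * (2 - ε) * t) t := by
    intro t
    refine ((((hasDerivAt_id t).pow 2).const_mul 2).sub_const 1 |>.add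
      ((((hasDerivAt_id t).pow 2).const_sub 1).const_mul ε)).congr_deriv ?_
    simp
    ring
  have hd1 : ∀ t ∈ Set.Ioo (1 / 2 - δ) (1 / 2 + δ), HasDerivAt (angPot g ε)
      (-2 * deriv g (-t) + deriv g (y t) * (2 * (2 - ε) * t)) t := by
    intro t ht
    refine ((((H _ (hneg t ht)).1.comp t (hasDerivAt_neg t)).const_mul 2).add
      ((H _ (hyr t ht)).1.comp t (hdy t))).congr_deriv ?_
    ring
  have hd2 : ∀ t ∈ Set.Ioo (1 / 2 - δ) (1 / 2 + δ),
      HasDerivAt (fun t => -2 * deriv g (-t) + deriv g (y t) * (2 * (2 - ε) * t))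
      (2 * deriv (deriv g) (-t) + deriv (deriv g) (y t) * (2 * (2 - ε) * t) ^ 2
        + deriv g (y t) * (2 * (2 - ε))) t := by
    intro t ht
    refine ((((H _ (hneg t ht)).2.1.comp t (hasDerivAt_neg t)).const_mul (-2)).add
      (((H _ (hyr t ht)).2.1.comp t (hdy t)).mul
        ((hasDerivAt_id t).const_mul (2 * (2 - ε))))).congr_deriv ?_
    simp
    ring
  -- The first term is at least 2k, the second is nonnegative, and the third is at least -(k/4)·4 =
  -- -k because |g'| ≤ k/4.
  have hd3 : ∀ t ∈ Set.Ioo (1 / 2 - δ) (1 / 2 + δ),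
      k ≤ 2 * deriv (deriv g) (-t) + deriv (deriv g) (y t) * (2 * (2 - ε) * t) ^ 2
        + deriv g (y t) * (2 * (2 - ε)) := by
    intro t ht
    have e1 := (H _ (hneg t ht)).2.2.1
    have e2 := (H _ (hyr t ht)).2.2.1
    have e3 := (abs_le.1 (H _ (hyr t ht)).2.2.2).1
    have e4 : 0 ≤ deriv (deriv g) (y t) * (2 * (2 - ε) * t) ^ 2 :=
      mul_nonneg (hk.le.trans e2) (sq_nonneg _)
    nlinarith
  have h2ε : 0 < 2 - ε := by linarith
  have hch1 : 1 / 2 - δ < (1 - ε) / (2 - ε) := by rw [lt_div_iff₀ h2ε]; nlinarith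
  have hch2 : (1 - ε) / (2 - ε) < 1 / 2 := by rw [div_lt_iff₀ h2ε]; linarith
  -- Sign change of the derivative: at (1-ε)/(2-ε) all cosines equal -t and it is -2εg'(-t) < 0; at
  -- 1/2 the first term vanishes and the third cosine exceeds -1/2, so it is positive.
  obtain ⟨t₀, ht₀, hcrit⟩ : ∃ t₀ ∈ Set.Ioo ((1 - ε) / (2 - ε)) (1 / 2),
      -2 * deriv g (-t₀) + deriv g (y t₀) * (2 * (2 - ε) * t₀) = 0 := by
    refine intermediate_value_Ioo hch2.le
      (f := fun t => -2 * deriv g (-t) + deriv g (y t) * (2 * (2 - ε) * t))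
      (fun t ht => (hd2 t ⟨hch1.trans_le ht.1, by linarith [ht.2]⟩).continuousAt.continuousWithinAt)
      ⟨?_, ?_⟩
    · have hyc : y ((1 - ε) / (2 - ε)) = -((1 - ε) / (2 - ε)) := by
        simp only [hy]
        field_simp
        ring
      have hp := hpos (-((1 - ε) / (2 - ε))) (by linarith) (by linarith)
      have e : 2 * (2 - ε) * ((1 - ε) / (2 - ε)) = 2 * (1 - ε) := by field_simp
      simp only [hyc, e]
      nlinarith
    · have hyc : y (1 / 2) = -1 / 2 + 3 / 4 * ε := by simp only [hy]; ring
      have hp := hpos (-1 / 2 + 3 / 4 * ε) (by linarith) (by linarith)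
      have e : deriv g (-(1 / 2)) = 0 := by rw [← hg.deriv_eq_zero]; norm_num
      simp only [hyc, e]
      have : 0 < 2 * (2 - ε) * (1 / 2) := by linarith
      have := mul_pos hp this
      linarith
  have ht₀I : t₀ ∈ Set.Ioo (1 / 2 - δ) (1 / 2 + δ) :=
    ⟨hch1.trans ht₀.1, by linarith [ht₀.2]⟩
  have hgI : ∀ t ∈ Set.Ioo (1 / 2 - δ) (1 / 2 + δ),
      k / 2 * (t - t₀) ^ 2 ≤ angPot g ε t - angPot g ε t₀ :=
    fun t ht => quadratic_growth_of_critical hd1 hd2 hd3 ht₀I hcrit ht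
  refine ⟨t₀, ht₀, hch1, fun t ht => ?_, ?_, ?_⟩
  · by_cases htI : t ∈ Set.Ioo (1 / 2 - δ) (1 / 2 + δ)
    · exact (mul_le_mul_of_nonneg_right (min_le_left _ _) (sq_nonneg _)).trans (hgI t htI)
    · have e1 := hgI (1 / 2) ⟨by linarith, by linarith⟩
      have e2 : angPot g ε (1 / 2) = g (-1 / 2 + 3 / 4 * ε) := by
        unfold angPot
        rw [show -(1 / 2 : ℝ) = -1 / 2 by norm_num, hg.zero]
        ring_nf
      have e3 := hsmall ε hε hεε₁
      have e4 := hg.angPot_nonneg hε.le (by linarith) ht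
      have e5 := hgrow (-t) ⟨by linarith [ht.2], by linarith [ht.1]⟩
      rw [hg.zero] at e5
      have e6 : δ ^ 2 ≤ (-t - -1 / 2) ^ 2 := by
        rw [Set.mem_Ioo, not_and_or, not_lt, not_lt] at htI
        rcases htI with h | h <;> nlinarith
      have e7 : (t - t₀) ^ 2 ≤ 1 := by nlinarith [ht.1, ht.2, ht₀I.1, ht₀I.2]
      have e8 : c₀ * δ ^ 2 ≤ c₀ * (-t - -1 / 2) ^ 2 := by gcongr
      have e9 : 0 ≤ k / 2 * (1 / 2 - t₀) ^ 2 := by positivity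
      calc _ ≤ c₀ * δ ^ 2 * 1 := by
            gcongr
            exact min_le_right _ _
        _ ≤ _ := by linarith
  · have := convexOn_sub_sq hd1 hd2 (k := 0) (fun t ht => hk.le.trans (hd3 t ht)) 0
    simpa using this
  · have hcd : ContDiffAt ℝ 2 (angPot g ε) t₀ := by
      have m1 := hneg t₀ ht₀I
      have m2 := hyr t₀ ht₀I
      refine (contDiffAt_const.mul ((hg.smooth (-t₀) ?_).comp t₀ contDiffAt_id.neg)).add
        ((hg.smooth (y t₀) ?_).comp t₀ (by fun_prop))
      · exact ⟨by linarith [m1.1], by linarith [m1.2]⟩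
      · exact ⟨by linarith [m2.1], by linarith [m2.2]⟩
    have := hcd.hasStrictDerivAt (by simp)
    rwa [(hd1 t₀ ht₀I).deriv, hcrit] at this

/-! ### The energy per atom as a function of the bond lengths -/

/-- The energy per atom of the tube with bond lengths `p.1`, `p.2` and minimal period `μ`. -/
noncomputable def atomEnergy (v₂ g : ℝ → ℝ) (ε μ : ℝ) (p : ℝ × ℝ) : ℝ :=
  1 / 2 * v₂ p.1 + v₂ p.2 + angPot g ε ((μ / 2 - p.1) / p.2)

theorem div_mem_Icc {μ : ℝ} {p : ℝ × ℝ} (hμ : μ ∈ Set.Ioo 2.6 3.1) (h1 : p.1 ∈ Set.Icc 0.9 1.1)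
    (h2 : p.2 ∈ Set.Icc 0.9 1.1) : (μ / 2 - p.1) / p.2 ∈ Set.Icc (0 : ℝ) 1 := by
  obtain ⟨a1, a2⟩ := hμ
  obtain ⟨b1, b2⟩ := h1
  obtain ⟨c1, c2⟩ := h2
  norm_num at a1 a2 b1 b2 c1 c2
  have hp : 0 < p.2 := by linarith
  exact ⟨div_nonneg (by linarith) hp.le, (div_le_one hp).2 (by linarith)⟩

/-- The second bound rests on μ - (2 + 2t₀) = 2((λ₁-1) + t(λ₂-1) + (t-t₀)) with 0 ≤ t ≤ 1;
Cauchy–Schwarz for three terms gives the factor 4·3 = 12. -/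
theorem atomEnergy_growth {v₂ g : ℝ → ℝ} {k c ε t₀ μ : ℝ} {p : ℝ × ℝ} (hk : 0 < k) (hc : 0 < c)
    (hv : ∀ x ∈ Set.Icc 0.9 1.1, k * (x - 1) ^ 2 ≤ v₂ x + 1)
    (hG : ∀ t ∈ Set.Icc (0 : ℝ) 1, c * (t - t₀) ^ 2 ≤ angPot g ε t - angPot g ε t₀)
    (hμ : μ ∈ Set.Ioo 2.6 3.1) (h1 : p.1 ∈ Set.Icc 0.9 1.1) (h2 : p.2 ∈ Set.Icc 0.9 1.1) :
    k / 2 * ((p.1 - 1) ^ 2 + (p.2 - 1) ^ 2)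
        ≤ atomEnergy v₂ g ε μ p - (-3 / 2 + angPot g ε t₀) ∧
      min (k / 2) c / 12 * (μ - (2 + 2 * t₀)) ^ 2
        ≤ atomEnergy v₂ g ε μ p - (-3 / 2 + angPot g ε t₀) := by
  have hmem := div_mem_Icc hμ h1 h2
  have e1 := hv _ h1
  have e2 := hv _ h2
  have e3 := hG _ hmem
  have hp : 0 < p.2 := lt_of_lt_of_le (by norm_num) h2.1
  unfold atomEnergy
  set t := (μ / 2 - p.1) / p.2 with ht
  have hμt : μ = 2 * p.1 + 2 * (t * p.2) := by rw [ht]; field_simp; ring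
  have q1 := sq_nonneg (p.1 - 1)
  have q2 := sq_nonneg (p.2 - 1)
  have q3 := sq_nonneg (t - t₀)
  have p1 := mul_nonneg hk.le q1
  have p2 := mul_nonneg hk.le q2
  have p3 := mul_nonneg hc.le q3
  constructor
  · linarith
  · have hm1 := min_le_left (k / 2) c
    have hm2 := min_le_right (k / 2) c
    have hm0 : 0 < min (k / 2) c := by positivity
    set κ := min (k / 2) c
    have hdec : μ - (2 + 2 * t₀) = 2 * ((p.1 - 1) + t * (p.2 - 1) + (t - t₀)) := by rw [hμt]; ring
    have ht2 : (t * (p.2 - 1)) ^ 2 ≤ (p.2 - 1) ^ 2 := by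
      rw [mul_pow]
      exact mul_le_of_le_one_left q2 (pow_le_one₀ hmem.1 hmem.2)
    have hsq : (μ - (2 + 2 * t₀)) ^ 2
        ≤ 12 * ((p.1 - 1) ^ 2 + (p.2 - 1) ^ 2 + (t - t₀) ^ 2) := by
      rw [hdec]
      nlinarith [sq_nonneg ((p.1 - 1) - t * (p.2 - 1)), sq_nonneg (t * (p.2 - 1) - (t - t₀)),
        sq_nonneg ((p.1 - 1) - (t - t₀))]
    have f1 := mul_le_mul_of_nonneg_right hm1 q1
    have f2 := mul_le_mul_of_nonneg_right hm1 q2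
    have f3 := mul_le_mul_of_nonneg_right hm2 q3
    have := mul_le_mul_of_nonneg_left hsq hm0.le
    linarith

/-- The angular variable at the midpoint of p and q differs from the mean of the angular variables
only to second order in p - q. Multiplied by the small Lipschitz constant k/10, this error is beaten
by the uniform convexity of v₂. -/
theorem atomEnergy_midpoint_lt {v₂ g : ℝ → ℝ} {k ε t₀ μ η s : ℝ} {p q : ℝ × ℝ} (hk : 0 < k)
    (hη : η ≤ 0.1) (hηs : 3 * η ≤ s) (ht₀ : t₀ ∈ Set.Icc (0 : ℝ) (1 / 2))
    (hv : ∀ x ∈ Set.Ioo (1 - η) (1 + η), ∀ y ∈ Set.Ioo (1 - η) (1 + η),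
      k * (x - y) ^ 2 ≤ v₂ x + v₂ y - 2 * v₂ ((x + y) / 2))
    (hconv : ConvexOn ℝ (Set.Ioo (t₀ - s) (t₀ + s)) (angPot g ε))
    (hlip : ∀ t ∈ Set.Ioo (t₀ - s) (t₀ + s), ∀ t' ∈ Set.Ioo (t₀ - s) (t₀ + s),
      |angPot g ε t - angPot g ε t'| ≤ k / 10 * |t - t'|)
    (hμ : |μ - (2 + 2 * t₀)| < η)
    (hp1 : p.1 ∈ Set.Ioo (1 - η) (1 + η)) (hp2 : p.2 ∈ Set.Ioo (1 - η) (1 + η))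
    (hq1 : q.1 ∈ Set.Ioo (1 - η) (1 + η)) (hq2 : q.2 ∈ Set.Ioo (1 - η) (1 + η)) (hne : p ≠ q) :
    2 * atomEnergy v₂ g ε μ ((p.1 + q.1) / 2, (p.2 + q.2) / 2)
      < atomEnergy v₂ g ε μ p + atomEnergy v₂ g ε μ q := by
  have hclose : ∀ a ∈ Set.Ioo (1 - η) (1 + η), ∀ b ∈ Set.Ioo (1 - η) (1 + η),
      (μ / 2 - a) / b ∈ Set.Ioo (t₀ - s) (t₀ + s) := by
    rintro a ⟨a1, a2⟩ b ⟨b1, b2⟩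
    obtain ⟨m1, m2⟩ := abs_lt.1 hμ
    obtain ⟨s1, s2⟩ := ht₀
    norm_num at hη
    have hη0 : 0 < η := by linarith
    have hb : 0 < b := by linarith
    constructor
    · rw [lt_div_iff₀ hb]; nlinarith
    · rw [div_lt_iff₀ hb]; nlinarith
  norm_num at hη
  have hmid : ∀ a ∈ Set.Ioo (1 - η) (1 + η), ∀ b ∈ Set.Ioo (1 - η) (1 + η),
      (a + b) / 2 ∈ Set.Ioo (1 - η) (1 + η) := by
    rintro a ⟨a1, a2⟩ b ⟨b1, b2⟩
    constructor <;> linarith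
  have hp2' : 0.9 < p.2 := by norm_num; linarith [hp2.1]
  have hq2' : 0.9 < q.2 := by norm_num; linarith [hq2.1]
  norm_num at hp2' hq2'
  have hpp : 0 < p.2 := by linarith
  have hqp : 0 < q.2 := by linarith
  have c1 := hclose _ hp1 _ hp2
  have c2 := hclose _ hq1 _ hq2
  have c3 := hclose _ (hmid _ hp1 _ hq1) _ (hmid _ hp2 _ hq2)
  have w1 := hv _ hp1 _ hq1
  have w2 := hv _ hp2 _ hq2
  unfold atomEnergy
  simp only
  set t := (μ / 2 - p.1) / p.2 with ht
  set t' := (μ / 2 - q.1) / q.2 with ht'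
  set tm := (μ / 2 - (p.1 + q.1) / 2) / ((p.2 + q.2) / 2) with htm
  have c4 : (t + t') / 2 ∈ Set.Ioo (t₀ - s) (t₀ + s) :=
    ⟨by linarith [c1.1, c2.1], by linarith [c1.2, c2.2]⟩
  have hcv := hconv.2 c1 c2 (by norm_num : (0 : ℝ) ≤ 1 / 2)
    (by norm_num : (0 : ℝ) ≤ 1 / 2) (by norm_num)
  rw [show (1 / 2 : ℝ) • t + (1 / 2 : ℝ) • t' = (t + t') / 2 by
    simp only [smul_eq_mul]; ring] at hcv
  simp only [smul_eq_mul] at hcv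
  have hl := (abs_le.1 (hlip _ c3 _ c4)).2
  -- The deviation is exactly (t - t')(p₂ - q₂)/(2(p₂ + q₂)), and 3.6 = 2(0.9 + 0.9).
  have hdist : |tm - (t + t') / 2| ≤ |t - t'| * |p.2 - q.2| / 3.6 := by
    have : tm - (t + t') / 2 = (t - t') * (p.2 - q.2) / (2 * (p.2 + q.2)) := by
      rw [htm, ht, ht']
      field_simp
      ring
    rw [this, abs_div, abs_mul, abs_of_pos (by positivity : 0 < 2 * (p.2 + q.2))]
    gcongr
    norm_num
    linarith
  have hst : t ∈ Set.Icc (-1 : ℝ) 1 ∧ t' ∈ Set.Icc (-1 : ℝ) 1 := by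
    obtain ⟨m1, m2⟩ := abs_lt.1 hμ
    obtain ⟨s1, s2⟩ := ht₀
    have := hp1.1; have := hp1.2; have := hq1.1; have := hq1.2
    rw [ht, ht']
    refine ⟨⟨?_, ?_⟩, ?_, ?_⟩
    · rw [le_div_iff₀ hpp]; linarith
    · rw [div_le_iff₀ hpp]; linarith
    · rw [le_div_iff₀ hqp]; linarith
    · rw [div_le_iff₀ hqp]; linarith
  have hΔt : |t - t'| * 0.9 ≤ |p.1 - q.1| + |p.2 - q.2| := by
    have e : (t - t') * p.2 = -(p.1 - q.1) - t' * (p.2 - q.2) := by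
      rw [ht, ht']
      field_simp
      ring
    have e' := congrArg abs e
    rw [abs_mul, abs_of_pos hpp] at e'
    calc |t - t'| * 0.9 ≤ |t - t'| * p.2 := by gcongr; norm_num; linarith
      _ = |-(p.1 - q.1) - t' * (p.2 - q.2)| := e'
      _ ≤ |-(p.1 - q.1)| + |t' * (p.2 - q.2)| := abs_sub _ _
      _ ≤ |p.1 - q.1| + 1 * |p.2 - q.2| := by
          rw [abs_neg, abs_mul]
          gcongr
          exact abs_le.2 hst.2
      _ = _ := by rw [one_mul]
  rw [← sq_abs] at w1 w2
  have hpos : 0 < |p.1 - q.1| ^ 2 + |p.2 - q.2| ^ 2 := by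
    rw [sq_abs, sq_abs]
    by_contra hcon
    have h1 : (p.1 - q.1) ^ 2 = 0 := by nlinarith [sq_nonneg (p.1 - q.1), sq_nonneg (p.2 - q.2)]
    have h2 : (p.2 - q.2) ^ 2 = 0 := by nlinarith [sq_nonneg (p.1 - q.1), sq_nonneg (p.2 - q.2)]
    exact hne (Prod.ext (sub_eq_zero.1 (pow_eq_zero_iff two_ne_zero |>.1 h1))
      (sub_eq_zero.1 (pow_eq_zero_iff two_ne_zero |>.1 h2)))
  have hA := abs_nonneg (p.1 - q.1)
  have hB := abs_nonneg (p.2 - q.2)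
  set A := |p.1 - q.1|
  set B := |p.2 - q.2|
  have hAB : |tm - (t + t') / 2| ≤ (A ^ 2 + B ^ 2) / 2 := by
    have := mul_le_mul_of_nonneg_right hΔt hB
    norm_num at this hdist
    nlinarith [sq_nonneg (A - B)]
  have hfin := mul_le_mul_of_nonneg_left hAB (by positivity : 0 ≤ k / 10)
  have := mul_pos hk hpos
  nlinarith [mul_nonneg hk.le (sq_nonneg A), mul_nonneg hk.le (sq_nonneg B)]

theorem atomEnergy_continuousOn {v₂ g : ℝ → ℝ} (h₂ : IsTwoBody v₂) (hg : IsWell g) {ε μ : ℝ}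
    (h0 : 0 ≤ ε) (h1 : ε ≤ 1) (hμ : μ ∈ Set.Ioo 2.6 3.1) :
    ContinuousOn (atomEnergy v₂ g ε μ) (Set.Icc 0.9 1.1 ×ˢ Set.Icc 0.9 1.1) := by
  have hv : ContinuousOn v₂ (Set.Ioi 0) := h₂.smooth.continuousOn
  have hpos : ∀ x ∈ Set.Icc (0.9 : ℝ) 1.1, x ∈ Set.Ioi (0 : ℝ) :=
    fun x hx => lt_of_lt_of_le (by norm_num) hx.1
  unfold atomEnergy
  refine ((continuousOn_const.mul (hv.comp continuous_fst.continuousOn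
    fun p hp => hpos _ hp.1)).add (hv.comp continuous_snd.continuousOn fun p hp => hpos _ hp.2)).add
    ((hg.angPot_continuousOn h0 h1).comp (ContinuousOn.div (by fun_prop) (by fun_prop)
      fun p hp => (hpos _ hp.2).ne') fun p hp => div_mem_Icc hμ hp.1 hp.2)

/-- A minimizer exists on the closed square. Every point with energy at most that of (1, 1) lies
within η of (1, 1), so the minimizer is interior and any rival lies in the region where the midpoint
comparison contradicts minimality. -/
theorem exists_unique_atomEnergy_minimizer {v₂ g : ℝ → ℝ} (h₂ : IsTwoBody v₂) (hg : IsWell g)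
    {k r c ε t₀ δ : ℝ} (hk : 0 < k) (hr : 0 < r) (hc : 0 < c) (h0 : 0 ≤ ε) (h1 : ε ≤ 1)
    (hv : ∀ x ∈ Set.Icc 0.9 1.1, k * (x - 1) ^ 2 ≤ v₂ x + 1)
    (hvm : ∀ x ∈ Set.Ioo (1 - r) (1 + r), ∀ y ∈ Set.Ioo (1 - r) (1 + r),
      k * (x - y) ^ 2 ≤ v₂ x + v₂ y - 2 * v₂ ((x + y) / 2))
    (hG : ∀ t ∈ Set.Icc (0 : ℝ) 1, c * (t - t₀) ^ 2 ≤ angPot g ε t - angPot g ε t₀)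
    (hconv : ConvexOn ℝ (Set.Ioo (1 / 2 - δ) (1 / 2 + δ)) (angPot g ε))
    (hd : HasStrictDerivAt (angPot g ε) 0 t₀) (ht₀ : t₀ ∈ Set.Ioo (1 / 2 - δ) (1 / 2))
    (hδ : δ ≤ 0.05) :
    ∃ R > 0, R ≤ 0.1 ∧ ∀ μ, |μ - (2 + 2 * t₀)| < R →
      ∃ p : ℝ × ℝ, p.1 ∈ Set.Ioo 0.9 1.1 ∧ p.2 ∈ Set.Ioo 0.9 1.1 ∧
        ∀ q : ℝ × ℝ, q.1 ∈ Set.Ioo 0.9 1.1 → q.2 ∈ Set.Ioo 0.9 1.1 → q ≠ p →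
          atomEnergy v₂ g ε μ p < atomEnergy v₂ g ε μ q := by
  obtain ⟨l1, l2⟩ := ht₀
  norm_num at hδ
  -- A strict derivative equal to 0 makes the local Lipschitz constant arbitrarily small; k/10 is
  -- what the midpoint comparison needs.
  obtain ⟨s, hs, hs1, hlip⟩ : ∃ s > 0, s ≤ min (t₀ - (1 / 2 - δ)) (1 / 2 + δ - t₀) ∧
      ∀ t ∈ Set.Ioo (t₀ - s) (t₀ + s), ∀ t' ∈ Set.Ioo (t₀ - s) (t₀ + s),
        |angPot g ε t - angPot g ε t'| ≤ k / 10 * |t - t'| := by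
    have hev := hd.isLittleO.bound (by positivity : 0 < k / 10)
    obtain ⟨s, hs, hb⟩ := Metric.eventually_nhds_iff_ball.1 hev
    refine ⟨min s (min (t₀ - (1 / 2 - δ)) (1 / 2 + δ - t₀)), lt_min hs (lt_min ?_ ?_),
      min_le_right _ _, fun t ht t' ht' => ?_⟩
    · linarith
    · linarith
    · have hm := min_le_left s (min (t₀ - (1 / 2 - δ)) (1 / 2 + δ - t₀))
      have := hb (t, t') (by
        rw [← ball_prod_same, Set.mem_prod, Real.ball_eq_Ioo]
        exact ⟨⟨by linarith [ht.1], by linarith [ht.2]⟩,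
          ⟨by linarith [ht'.1], by linarith [ht'.2]⟩⟩)
      simpa using this
  have hsub : Set.Ioo (t₀ - s) (t₀ + s) ⊆ Set.Ioo (1 / 2 - δ) (1 / 2 + δ) := by
    rw [le_min_iff] at hs1
    exact Set.Ioo_subset_Ioo (by linarith) (by linarith)
  obtain ⟨η, hη, hη1, hηs, hηr⟩ : ∃ η > 0, η ≤ 0.1 ∧ 3 * η ≤ s ∧ η ≤ r :=
    ⟨min 0.1 (min (s / 3) r), by positivity, min_le_left _ _,
      by linarith [(min_le_right 0.1 (min (s / 3) r)).trans (min_le_left _ _)],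
      (min_le_right _ _).trans (min_le_right _ _)⟩
  -- By continuity, for μ close to 2 + 2t₀ unit bonds cost less than the energy needed to move a
  -- bond length by η.
  obtain ⟨R, hR, hRc⟩ : ∃ R > 0, ∀ μ, |μ - (2 + 2 * t₀)| < R →
      angPot g ε (μ / 2 - 1) < angPot g ε t₀ + k / 2 * η ^ 2 := by
    have hcont : ContinuousAt (fun μ : ℝ => angPot g ε (μ / 2 - 1)) (2 + 2 * t₀) := by
      refine ContinuousAt.comp (g := angPot g ε) (f := fun μ : ℝ => μ / 2 - 1) ?_ ?_
      · rw [show (2 + 2 * t₀) / 2 - 1 = t₀ by ring]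
        exact hd.hasDerivAt.continuousAt
      · fun_prop
    have hev := hcont.tendsto.eventually_lt_const (by
      rw [show (2 + 2 * t₀) / 2 - 1 = t₀ by ring]
      have : 0 < k / 2 * η ^ 2 := by positivity
      linarith : _ < angPot g ε t₀ + k / 2 * η ^ 2)
    obtain ⟨R, hR, hb⟩ := Metric.eventually_nhds_iff_ball.1 hev
    exact ⟨R, hR, fun μ hμ => hb μ (by rwa [Metric.mem_ball, Real.dist_eq])⟩
  refine ⟨min R η, by positivity, (min_le_right _ _).trans hη1, fun μ hμ => ?_⟩
  obtain ⟨hμR, hμη⟩ := lt_min_iff.1 hμ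
  have hμI : μ ∈ Set.Ioo 2.6 3.1 := by
    obtain ⟨m1, m2⟩ := abs_lt.1 hμη
    norm_num at hη1
    constructor <;> norm_num <;> linarith
  have hone : (1 : ℝ) ∈ Set.Icc 0.9 1.1 := by constructor <;> norm_num
  have hnear : ∀ p : ℝ × ℝ, p.1 ∈ Set.Icc 0.9 1.1 → p.2 ∈ Set.Icc 0.9 1.1 →
      atomEnergy v₂ g ε μ p ≤ atomEnergy v₂ g ε μ (1, 1) →
      p.1 ∈ Set.Ioo (1 - η) (1 + η) ∧ p.2 ∈ Set.Ioo (1 - η) (1 + η) := by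
    intro p hp1 hp2 hle
    have e1 := (atomEnergy_growth hk hc hv hG hμI hp1 hp2).1
    have e2 : atomEnergy v₂ g ε μ (1, 1) = -3 / 2 + angPot g ε (μ / 2 - 1) := by
      simp only [atomEnergy, h₂.value_one, div_one]
      norm_num
    have e3 := hRc μ hμR
    have e4 : k / 2 * ((p.1 - 1) ^ 2 + (p.2 - 1) ^ 2) < k / 2 * η ^ 2 := by linarith
    have e5 := lt_of_mul_lt_mul_left e4 (by positivity)
    have a1 := abs_lt_of_sq_lt_sq (by nlinarith [sq_nonneg (p.2 - 1)] : (p.1 - 1) ^ 2 < η ^ 2) hη.le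
    have a2 := abs_lt_of_sq_lt_sq (by nlinarith [sq_nonneg (p.1 - 1)] : (p.2 - 1) ^ 2 < η ^ 2) hη.le
    rw [abs_lt] at a1 a2
    exact ⟨⟨by linarith, by linarith⟩, by linarith, by linarith⟩
  have hin : ∀ x ∈ Set.Ioo (1 - η) (1 + η), x ∈ Set.Ioo (0.9 : ℝ) 1.1 := by
    rintro x ⟨x1, x2⟩
    norm_num at hη1
    constructor <;> norm_num <;> linarith
  obtain ⟨p, hp, hpm⟩ := (isCompact_Icc.prod isCompact_Icc).exists_isMinOn
    ⟨((1 : ℝ), (1 : ℝ)), hone, hone⟩ (atomEnergy_continuousOn h₂ hg h0 h1 hμI)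
  have hple : atomEnergy v₂ g ε μ p ≤ atomEnergy v₂ g ε μ (1, 1) :=
    hpm (show ((1 : ℝ), (1 : ℝ)) ∈ _ from ⟨hone, hone⟩)
  obtain ⟨n1, n2⟩ := hnear p hp.1 hp.2 hple
  refine ⟨p, hin _ n1, hin _ n2, fun q hq1 hq2 hne => ?_⟩
  by_contra hcon
  rw [not_lt] at hcon
  obtain ⟨o1, o2⟩ := hnear q (Set.Ioo_subset_Icc_self hq1) (Set.Ioo_subset_Icc_self hq2)
    (hcon.trans hple)
  have hmid := atomEnergy_midpoint_lt hk hη1 hηs ⟨by linarith, l2.le⟩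
    (fun x hx y hy => hvm x ⟨by linarith [hx.1], by linarith [hx.2]⟩ y
      ⟨by linarith [hy.1], by linarith [hy.2]⟩)
    (hconv.subset hsub (convex_Ioo _ _)) hlip hμη n1 n2 o1 o2 hne.symm
  have hmem : ((p.1 + q.1) / 2, (p.2 + q.2) / 2) ∈ Set.Icc (0.9 : ℝ) 1.1 ×ˢ Set.Icc (0.9 : ℝ) 1.1 :=
    ⟨⟨by linarith [hp.1.1, hq1.1], by linarith [hp.1.2, hq1.2]⟩,
      ⟨by linarith [hp.2.1, hq2.1], by linarith [hp.2.2, hq2.2]⟩⟩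
  have hlow : atomEnergy v₂ g ε μ p
      ≤ atomEnergy v₂ g ε μ ((p.1 + q.1) / 2, (p.2 + q.2) / 2) := hpm hmem
  linarith

/-! ### Bonds of periodic configurations -/

theorem round_eq_of_abs_sub_lt {z : ℝ} {t : ℤ} (h : |z - t| < 1 / 2) : round z = t := by
  obtain ⟨h1, h2⟩ := abs_lt.1 h
  rw [round_eq, Int.floor_eq_iff]
  constructor <;> linarith

theorem bondVec_eq_of_abs_lt {L : ℝ} (hL : 0 < L) {x y : Point} {t : ℤ}
    (h : |x 0 - y 0 - L * t| < L / 2) : bondVec L x y = x - y - (L * t : ℝ) • e₁ := by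
  have hr : round ((x 0 - y 0) / L) = t := by
    apply round_eq_of_abs_sub_lt
    rw [show (x 0 - y 0) / L - t = (x 0 - y 0 - L * t) / L by field_simp, abs_div, abs_of_pos hL,
      div_lt_iff₀ hL]
    linarith
  rw [bondVec, hr]

theorem norm_sub_axis_sq (x y : Point) (s : ℝ) :
    ‖x - y - s • e₁‖ ^ 2 = (x 0 - y 0 - s) ^ 2 + (x 1 - y 1) ^ 2 + (x 2 - y 2) ^ 2 := by
  have := norm_add_axis_sq (x - y) (-s)
  rw [neg_smul, ← sub_eq_add_neg] at this
  rw [this]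
  simp [← sub_eq_add_neg]

theorem abs_axis_le_norm (x y : Point) (s : ℝ) : |x 0 - y 0 - s| ≤ ‖x - y - s • e₁‖ := by
  apply abs_le_of_sq_le_sq _ (norm_nonneg _)
  rw [norm_sub_axis_sq]
  nlinarith [sq_nonneg (x 1 - y 1), sq_nonneg (x 2 - y 2)]

theorem distMod_lt_iff {L : ℝ} (hL : 0 < L) {x y : Point} {r : ℝ} :
    distMod L x y < r ↔ ∃ t : ℤ, ‖x - y - (L * t : ℝ) • e₁‖ < r := by
  refine ⟨fun h => ⟨_, h⟩, fun ⟨t, ht⟩ => lt_of_le_of_lt (distMod_le L hL x y (-t)) ?_⟩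
  have e : x - y + (L * ((-t : ℤ) : ℝ)) • e₁ = x - y - (L * t : ℝ) • e₁ := by
    push_cast
    module
  rwa [e]

/-- As 2·1.1 < 2.6, a short displacement has axial part below half a period, so rounding selects
this very translate. This covers m = 1 as well. -/
theorem bondVec_eq_of_norm_lt {L : ℝ} (hL : 2.6 ≤ L) {x y : Point} {t : ℤ}
    (h : ‖x - y - (L * t : ℝ) • e₁‖ < 1.1) : bondVec L x y = x - y - (L * t : ℝ) • e₁ := by
  have := abs_axis_le_norm x y (L * t)
  norm_num at h hL
  exact bondVec_eq_of_abs_lt (by linarith) (by linarith)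

theorem distMod_lt_symm {L : ℝ} (hL : 0 < L) {x y : Point} {r : ℝ} (h : distMod L x y < r) :
    distMod L y x < r := by
  obtain ⟨t, ht⟩ := (distMod_lt_iff hL).1 h
  refine (distMod_lt_iff hL).2 ⟨-t, ?_⟩
  have e : y - x - (L * ((-t : ℤ) : ℝ)) • e₁ = -(x - y - (L * t : ℝ) • e₁) := by
    push_cast
    module
  rwa [e, norm_neg]

theorem mem_bonds {ι : Type} [Fintype ι] {C : Config ι} {a b : ι} :
    (a, b) ∈ bonds C ↔ a ≠ b ∧ distMod C.period (C.pos a) (C.pos b) < 1.1 := by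
  simp [bonds]

theorem mem_bonds_comm {ι : Type} [Fintype ι] {C : Config ι} (hL : 0 < C.period) {a b : ι} :
    (a, b) ∈ bonds C ↔ (b, a) ∈ bonds C := by
  rw [mem_bonds, mem_bonds]
  exact ⟨fun h => ⟨h.1.symm, distMod_lt_symm hL h.2⟩, fun h => ⟨h.1.symm, distMod_lt_symm hL h.2⟩⟩

/-- The energy of a configuration in which every atom has three bonds, two of them equivalent. -/
theorem energy_eq_of_three_bonds {v₂ v₃ : ℝ → ℝ} {ι : Type} [Fintype ι] {C : Config ι}
    (hL : 0 < C.period) {A B P Q : ℝ}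
    (h : ∀ b, ∃ n₁ n₂ n₃, n₁ ≠ n₂ ∧ n₁ ≠ n₃ ∧ n₂ ≠ n₃ ∧
      (∀ a, (a, b) ∈ bonds C ↔ a = n₁ ∨ a = n₂ ∨ a = n₃) ∧
      v₂ (distMod C.period (C.pos n₁) (C.pos b)) = A ∧
      v₂ (distMod C.period (C.pos n₂) (C.pos b)) = B ∧
      v₂ (distMod C.period (C.pos n₃) (C.pos b)) = B ∧
      v₃ (bondAngle C n₁ b n₂) = P ∧ v₃ (bondAngle C n₁ b n₃) = P ∧
      v₃ (bondAngle C n₂ b n₃) = Q) :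
    energy v₂ v₃ C = Fintype.card ι * (1 / 2 * A + B + (2 * P + Q)) := by
  classical
  have hcomm : ∀ a b c, bondAngle C a b c = bondAngle C c b a :=
    fun a b c => InnerProductGeometry.angle_comm _ _
  have hbond : ∀ b, ∑ a, (if (a, b) ∈ bonds C then v₂ (distMod C.period (C.pos a) (C.pos b))
      else 0) = A + 2 * B := by
    intro b
    obtain ⟨n₁, n₂, n₃, h12, h13, h23, hn, e1, e2, e3, -⟩ := h b
    rw [← Finset.sum_filter, show Finset.univ.filter (fun a => (a, b) ∈ bonds C) = {n₁, n₂, n₃} by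
      ext a; simp [hn], Finset.sum_insert (by simp [h12, h13]), Finset.sum_insert (by simp [h23]),
      Finset.sum_singleton, e1, e2, e3]
    ring
  have hang : ∀ b, ∑ a, ∑ c, (if a ≠ c ∧ (a, b) ∈ bonds C ∧ (b, c) ∈ bonds C then
      v₃ (bondAngle C a b c) else 0) = 4 * P + 2 * Q := by
    intro b
    obtain ⟨n₁, n₂, n₃, h12, h13, h23, hn, -, -, -, e1, e2, e3⟩ := h b
    have hset : Finset.univ.filter (fun a => (a, b) ∈ bonds C) = {n₁, n₂, n₃} := by
      ext a; simp [hn]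
    -- By symmetry of bonding both outer atoms of the triple range over the same three neighbours of
    -- b. Each unordered pair is met twice, which cancels the factor 1/2 in the energy.
    have hrw : ∀ a c, (if a ≠ c ∧ (a, b) ∈ bonds C ∧ (b, c) ∈ bonds C then
        v₃ (bondAngle C a b c) else 0) = if (a, b) ∈ bonds C then
          (if (c, b) ∈ bonds C then (if a ≠ c then v₃ (bondAngle C a b c) else 0) else 0)
          else 0 := by
      intro a c
      simp only [mem_bonds_comm hL (a := b) (b := c)]
      split_ifs <;> tauto
    have hinner : ∀ a, ∑ c, (if (a, b) ∈ bonds C then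
          (if (c, b) ∈ bonds C then (if a ≠ c then v₃ (bondAngle C a b c) else 0) else 0)
          else 0) = if (a, b) ∈ bonds C then
            ∑ c ∈ ({n₁, n₂, n₃} : Finset ι), (if a ≠ c then v₃ (bondAngle C a b c) else 0)
            else 0 := by
      intro a
      split_ifs
      · rw [← Finset.sum_filter, hset]
      · simp
    simp only [hrw, hinner]
    rw [← Finset.sum_filter, hset]
    have hsum : ∀ f : ι → ℝ, ∑ x ∈ ({n₁, n₂, n₃} : Finset ι), f x = f n₁ + (f n₂ + f n₃) := by
      intro f
      rw [Finset.sum_insert (by simp [h12, h13]), Finset.sum_insert (by simp [h23]),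
        Finset.sum_singleton]
    simp only [hsum,
      ne_eq, not_true_eq_false, if_false, h12, h13, h23, h12.symm, h13.symm, h23.symm,
      not_false_eq_true, if_true, hcomm n₂ b n₁, hcomm n₃ b n₁, hcomm n₃ b n₂, e1, e2, e3]
    ring
  have s1 : ∑ p ∈ bonds C, v₂ (distMod C.period (C.pos p.1) (C.pos p.2))
      = Fintype.card ι * (A + 2 * B) := by
    rw [← Finset.univ_inter (bonds C), ← Finset.sum_ite_mem, Fintype.sum_prod_type_right]
    simp only [hbond, Finset.sum_const, Finset.card_univ, nsmul_eq_mul]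
  have s2 : ∑ t ∈ triples C, v₃ (bondAngle C t.1 t.2.1 t.2.2)
      = Fintype.card ι * (4 * P + 2 * Q) := by
    rw [triples, Finset.sum_filter, Fintype.sum_prod_type]
    simp only [Fintype.sum_prod_type]
    rw [Finset.sum_comm]
    simp only [hang, Finset.sum_const, Finset.card_univ, nsmul_eq_mul]
  rw [energy, s1, s2]
  ring

/-! ### The geometry of zigzag tubes -/

/-- The displacement on a cylinder of radius `ρ` by `x` along the axis and, starting at angle `θ`,
by the angle `φ`. -/
noncomputable def displ (ρ x θ φ : ℝ) : Point :=
  !₂[x, ρ * (cos (θ + φ) - cos θ), ρ * (sin (θ + φ) - sin θ)]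

theorem inner_displ (ρ x x' θ φ φ' : ℝ) : inner ℝ (displ ρ x θ φ) (displ ρ x' θ φ')
    = x * x' + ρ ^ 2 * (1 + cos (φ - φ') - cos φ - cos φ') := by
  simp only [displ, PiLp.inner_apply, Fin.sum_univ_three, cos_add, sin_add, cos_sub]
  simp
  linear_combination
    ρ ^ 2 * (1 - cos φ - cos φ' + cos φ * cos φ' + sin φ * sin φ') * sin_sq_add_cos_sq θ

theorem norm_displ_sq (ρ x θ φ : ℝ) :
    ‖displ ρ x θ φ‖ ^ 2 = x ^ 2 + 4 * ρ ^ 2 * sin (φ / 2) ^ 2 := by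
  rw [← real_inner_self_eq_norm_sq, inner_displ, sub_self, cos_zero, sin_sq_eq_half_sub,
    mul_div_cancel₀ _ two_ne_zero]
  ring

theorem displ_add_two_pi (ρ x θ φ : ℝ) (z : ℤ) : displ ρ x θ (φ + z * (2 * π)) = displ ρ x θ φ := by
  simp only [displ, ← add_assoc, cos_add_int_mul_two_pi, sin_add_int_mul_two_pi]

/-- The axial position of an atom relative to the minimal period it belongs to. -/
noncomputable def axialOffset (μ lam₁ : ℝ) (k l : Fin 2) : ℝ :=
  (k : ℕ) * (lam₁ + sigma μ lam₁) + (l : ℕ) * (2 * sigma μ lam₁ + lam₁)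

/-- The angular position of an atom. -/
noncomputable def polarAngle {ℓ m : ℕ} (a : Label ℓ m) : ℝ :=
  π * (2 * (a.1 : ℕ) + (a.2.2.1 : ℕ)) / ℓ

/-- Here q counts minimal periods and d counts angular steps π/ℓ; t and z record the wrapping along
the axis and around it. The displacement depends on the labels i and j only through q, d and the
starting angle. -/
theorem tube_pos_sub {ℓ m : ℕ} (hℓ : 0 < ℓ) {μ lam₁ lam₂ : ℝ} (a b : Label ℓ m) {q d t z : ℤ}
    (hq : ((a.2.1 : ℕ) : ℤ) - (b.2.1 : ℕ) - q = m * t)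
    (hd : (2 * ((a.1 : ℕ) : ℤ) + (a.2.2.1 : ℕ)) - (2 * ((b.1 : ℕ) : ℤ) + (b.2.2.1 : ℕ)) - d
      = 2 * ℓ * z) :
    (tube ℓ m lam₁ lam₂ μ).pos a - (tube ℓ m lam₁ lam₂ μ).pos b - (m * μ * t : ℝ) • e₁
      = displ (rho ℓ μ lam₁ lam₂)
        (μ * q + axialOffset μ lam₁ a.2.2.1 a.2.2.2 - axialOffset μ lam₁ b.2.2.1 b.2.2.2)
        (polarAngle b) (π * d / ℓ) := by
  have hℓ' : (ℓ : ℝ) ≠ 0 := by positivity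
  have hq' : ((a.2.1 : ℕ) : ℝ) - (b.2.1 : ℕ) - q = m * t := by exact_mod_cast hq
  have hd' : (2 * ((a.1 : ℕ) : ℝ) + (a.2.2.1 : ℕ)) - (2 * ((b.1 : ℕ) : ℝ) + (b.2.2.1 : ℕ)) - d
      = 2 * ℓ * z := by exact_mod_cast hd
  have hθ : polarAngle a = polarAngle b + (π * d / ℓ + z * (2 * π)) := by
    unfold polarAngle
    field_simp
    linear_combination hd'
  rw [← displ_add_two_pi _ _ _ _ z]
  unfold displ
  rw [← hθ]
  ext n
  fin_cases n
  · simp [tube, atom, e₁, axialOffset, sigma]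
    linear_combination μ * hq'
  · simp [tube, atom, e₁, polarAngle]
    ring
  · simp [tube, atom, e₁, polarAngle]
    ring

/-- By π-periodicity and the reflection about π/2, d may be replaced by an integer in [n, ℓ], where
the sine is increasing. -/
theorem sin_sq_le_sin_sq_of_dist {ℓ : ℕ} (hℓ : 0 < ℓ) {n : ℕ} {d : ℤ}
    (h : ∀ z : ℤ, (n : ℤ) ≤ |d - 2 * ℓ * z|) :
    sin (π * n / (2 * ℓ)) ^ 2 ≤ sin (π * d / (2 * ℓ)) ^ 2 := by
  have hℓ' : (0 : ℝ) < ℓ := by positivity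
  have hpos : (0 : ℤ) < 2 * ℓ := by positivity
  set r := d % (2 * ℓ) with hr
  set z := d / (2 * ℓ) with hz
  have hdz : d = r + 2 * ℓ * z := (Int.emod_add_mul_ediv d (2 * ℓ)).symm
  have hr0 : 0 ≤ r := Int.emod_nonneg _ hpos.ne'
  have hr1 : r < 2 * ℓ := Int.emod_lt_of_pos _ hpos
  have h1 : (n : ℤ) ≤ r := by
    have := h z
    rwa [hdz, add_sub_cancel_right, abs_of_nonneg hr0] at this
  have h2 : (n : ℤ) ≤ 2 * ℓ - r := by
    have := h (z + 1)
    rwa [hdz, show r + 2 * ℓ * z - 2 * ℓ * (z + 1) = -(2 * ℓ - r) by ring, abs_neg,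
      abs_of_nonneg (by linarith)] at this
  have key : ∀ s : ℤ, (n : ℤ) ≤ s → s ≤ ℓ →
      sin (π * n / (2 * ℓ)) ^ 2 ≤ sin (π * s / (2 * ℓ)) ^ 2 := by
    intro s hs1 hs2
    have hs1' : (n : ℝ) ≤ s := by exact_mod_cast hs1
    have hs2' : (s : ℝ) ≤ ℓ := by exact_mod_cast hs2
    have e1 : π * n / (2 * ℓ) ≤ π * s / (2 * ℓ) := by gcongr
    have e0 : 0 ≤ π * n / (2 * ℓ) := by positivity
    have e2 : π * s / (2 * ℓ) ≤ π / 2 := by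
      rw [div_le_div_iff₀ (by positivity) two_pos]
      nlinarith [pi_pos]
    have hle := sin_le_sin_of_le_of_le_pi_div_two (by linarith [pi_pos]) e2 e1
    exact pow_le_pow_left₀ (sin_nonneg_of_nonneg_of_le_pi e0 (by linarith [pi_pos])) hle 2
  have hred : sin (π * d / (2 * ℓ)) ^ 2 = sin (π * r / (2 * ℓ)) ^ 2 := by
    have e : π * d / (2 * ℓ) = π * r / (2 * ℓ) + z * π := by
      have : (d : ℝ) = r + 2 * ℓ * z := by exact_mod_cast hdz
      rw [this]
      field_simp
    rw [e, sin_add_int_mul_pi, mul_pow, ← sq_abs ((-1 : ℝ) ^ z), abs_zpow]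
    simp
  rw [hred]
  rcases le_total r ℓ with hle | hle
  · exact key r h1 hle
  · have := key (2 * ℓ - r) h2 (by linarith)
    refine this.trans_eq ?_
    have e : π * ((2 * ℓ - r : ℤ) : ℝ) / (2 * ℓ) = π - π * r / (2 * ℓ) := by
      push_cast
      field_simp
    rw [e, sin_pi_sub]

theorem sigma_mem {μ lam₁ : ℝ} (hμ : μ ∈ Set.Ioo 2.6 3.1) (h₁ : lam₁ ∈ Set.Ioo 0.9 1.1) :
    0.2 < sigma μ lam₁ ∧ sigma μ lam₁ < 0.65 := by
  obtain ⟨a1, a2⟩ := hμ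
  obtain ⟨b1, b2⟩ := h₁
  unfold sigma
  norm_num at a1 a2 b1 b2 ⊢
  constructor <;> linarith

theorem chord_sq {ℓ : ℕ} (hℓ : 3 < ℓ) {μ lam₁ lam₂ : ℝ} (hμ : μ ∈ Set.Ioo 2.6 3.1)
    (h₁ : lam₁ ∈ Set.Ioo 0.9 1.1) (h₂ : lam₂ ∈ Set.Ioo 0.9 1.1) :
    sigma μ lam₁ ^ 2 + 4 * rho ℓ μ lam₁ lam₂ ^ 2 * sin (π / (2 * ℓ)) ^ 2 = lam₂ ^ 2 :=
  ((zigzagParams_iff ℓ hℓ μ lam₁ lam₂ _ _ hμ h₁ h₂).2 ⟨rfl, rfl⟩).bond_eq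

theorem sin_sq_le_of_lt {ℓ : ℕ} (hℓ : 3 < ℓ) : sin (π / (2 * ℓ)) ^ 2 ≤ 0.16 := by
  have hℓ' : (4 : ℝ) ≤ ℓ := by exact_mod_cast hℓ
  have h0 : 0 ≤ π / (2 * ℓ) := by positivity
  have h1 : π / (2 * ℓ) ≤ 0.4 := by
    rw [div_le_iff₀ (by positivity)]
    nlinarith [pi_lt_d2]
  have h2 := sin_le h0
  have h3 := sin_nonneg_of_nonneg_of_le_pi h0 (by linarith [pi_gt_three])
  nlinarith

/-- Atoms at least two angular steps apart are never bonded: their lateral distance alone reaches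
1.1. -/
theorem even_chord_sq_ge {ℓ : ℕ} (hℓ : 3 < ℓ) {μ lam₁ lam₂ : ℝ} (hμ : μ ∈ Set.Ioo 2.6 3.1)
    (h₁ : lam₁ ∈ Set.Ioo 0.9 1.1) (h₂ : lam₂ ∈ Set.Ioo 0.9 1.1) {d : ℤ}
    (hd : ∀ z : ℤ, 2 ≤ |d - 2 * ℓ * z|) :
    1.21 ≤ 4 * rho ℓ μ lam₁ lam₂ ^ 2 * sin (π * d / (2 * ℓ)) ^ 2 := by
  have h := sin_sq_le_sin_sq_of_dist (by omega : 0 < ℓ) (n := 2) hd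
  have hs := sin_sq_le_of_lt hℓ
  have hc := chord_sq hℓ hμ h₁ h₂
  obtain ⟨s1, s2⟩ := sigma_mem hμ h₁
  obtain ⟨l1, l2⟩ := h₂
  have e : sin (π * (2 : ℕ) / (2 * ℓ)) ^ 2
      = 4 * sin (π / (2 * ℓ)) ^ 2 * (1 - sin (π / (2 * ℓ)) ^ 2) := by
    rw [show π * (2 : ℕ) / (2 * ℓ) = 2 * (π / (2 * ℓ)) by push_cast; ring, sin_two_mul, mul_pow,
      cos_sq']
    ring
  rw [e] at h
  have h' := mul_le_mul_of_nonneg_left h (by positivity : 0 ≤ 4 * rho ℓ μ lam₁ lam₂ ^ 2)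
  refine le_trans ?_ h'
  set s := sin (π / (2 * ℓ)) ^ 2
  set S := 4 * rho ℓ μ lam₁ lam₂ ^ 2 * s with hS
  norm_num at *
  -- S = λ₂² - σ² ≥ 0.81 - 0.4225, and then 4S(1 - s) ≥ 4·0.38·0.84 > 1.21.
  have hS1 : 0.38 ≤ S := by norm_num; nlinarith
  norm_num at hS1
  rw [show 4 * rho ℓ μ lam₁ lam₂ ^ 2 * (4 * s * (1 - s)) = 4 * S * (1 - s) by rw [hS]; ring]
  nlinarith

/-- Consecutive sections of the tube are alternately σ and λ₁ apart, and two steps cover μ/2 > 1.1.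
Only the section itself and its two neighbours are within reach. The proof bounds q and checks the
finitely many linear cases. -/
theorem axial_cases {μ lam₁ : ℝ} (hμ : μ ∈ Set.Ioo 2.6 3.1) (h₁ : lam₁ ∈ Set.Ioo 0.9 1.1)
    {k l k' l' : Fin 2} {q : ℤ}
    (h : |μ * q + axialOffset μ lam₁ k' l' - axialOffset μ lam₁ k l| < 1.1) :
    (k' = k ∧ l' = l ∧ q = 0) ∨
      (k' = k ∧ l' = 1 - l ∧ q = 2 * ((l : ℕ) : ℤ) - 1) ∨
      (k' = 1 - k ∧ l' = 1 - l ∧ q = ((k : ℕ) : ℤ) + (l : ℕ) - 1) := by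
  obtain ⟨s1, s2⟩ := sigma_mem hμ h₁
  have hμs : μ = 2 * sigma μ lam₁ + 2 * lam₁ := by unfold sigma; ring
  obtain ⟨m1, m2⟩ := hμ
  obtain ⟨b1, b2⟩ := h₁
  obtain ⟨a1, a2⟩ := abs_lt.1 h
  have hoff : ∀ k l : Fin 2, 0 ≤ axialOffset μ lam₁ k l ∧
      axialOffset μ lam₁ k l ≤ 3 * sigma μ lam₁ + 2 * lam₁ := by
    intro k l
    norm_num at *
    fin_cases k <;> fin_cases l <;> simp [axialOffset] <;> (try constructor) <;> linarith
  have o1 := hoff k l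
  have o2 := hoff k' l'
  norm_num at m1 m2 b1 b2 s1 s2 a1 a2
  have hq1 : -2 < q := by
    have : (-2 : ℝ) < q := by by_contra hcon; nlinarith
    exact_mod_cast this
  have hq2 : q < 2 := by
    have : (q : ℝ) < 2 := by by_contra hcon; nlinarith
    exact_mod_cast this
  clear hoff o1 o2 h
  unfold axialOffset at a1 a2
  generalize sigma μ lam₁ = σ at *
  subst hμs
  interval_cases q <;> fin_cases k <;> fin_cases l <;> fin_cases k' <;> fin_cases l' <;>
    simp at a1 a2 ⊢ <;> linarith

theorem exists_fin_dvd_sub {n : ℕ} (hn : 0 < n) (z : ℤ) :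
    ∃ i : Fin n, ∃ t : ℤ, ((i : ℕ) : ℤ) - z = n * t := by
  have hn' : (0 : ℤ) < n := by exact_mod_cast hn
  have h0 := Int.emod_nonneg z hn'.ne'
  have h1 := Int.emod_lt_of_pos z hn'
  refine ⟨⟨(z % n).toNat, by omega⟩, -(z / n), ?_⟩
  have := Int.emod_add_mul_ediv z n
  simp only [Int.toNat_of_nonneg h0]
  linarith

theorem fin_eq_of_sub_eq_mul {n : ℕ} {i j : Fin n} {t : ℤ}
    (h : ((i : ℕ) : ℤ) - (j : ℕ) = n * t) : i = j := by
  have h1 : ((i : ℕ) : ℤ) < n := by exact_mod_cast i.2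
  have h2 : ((j : ℕ) : ℤ) < n := by exact_mod_cast j.2
  have h3 : |((i : ℕ) : ℤ) - (j : ℕ)| < n := abs_lt.2 ⟨by omega, by omega⟩
  have := Int.eq_zero_of_abs_lt_dvd ⟨t, h⟩ h3
  exact Fin.ext (by omega)

/-- The axial direction of the bond which is parallel to the axis. -/
def axialSign (l : Fin 2) : ℝ := 2 * (l : ℕ) - 1

theorem axialSign_sq (l : Fin 2) : axialSign l ^ 2 = 1 := by
  fin_cases l <;> norm_num [axialSign]

theorem axial_parallel (μ lam₁ : ℝ) (k l : Fin 2) :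
    μ * ((2 * ((l : ℕ) : ℤ) - 1 : ℤ) : ℝ) + axialOffset μ lam₁ k (1 - l) - axialOffset μ lam₁ k l
      = axialSign l * lam₁ := by
  fin_cases k <;> fin_cases l <;> simp [axialOffset, axialSign, sigma] <;> ring

theorem axial_zigzag (μ lam₁ : ℝ) (k l : Fin 2) :
    μ * ((((k : ℕ) : ℤ) + (l : ℕ) - 1 : ℤ) : ℝ) + axialOffset μ lam₁ (1 - k) (1 - l)
      - axialOffset μ lam₁ k l = -axialSign l * sigma μ lam₁ := by
  fin_cases k <;> fin_cases l <;> simp [axialOffset, axialSign, sigma] <;> ring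

/-- Every atom of a zigzag tube is bonded to exactly three atoms. -/
theorem tube_neighbors {ℓ m : ℕ} (hℓ : 3 < ℓ) (hm : 0 < m) {μ lam₁ lam₂ : ℝ}
    (hμ : μ ∈ Set.Ioo 2.6 3.1) (h₁ : lam₁ ∈ Set.Ioo 0.9 1.1) (h₂ : lam₂ ∈ Set.Ioo 0.9 1.1)
    (b : Label ℓ m) :
    ∃ n₁ n₂ n₃ : Label ℓ m, n₁ ≠ n₂ ∧ n₁ ≠ n₃ ∧ n₂ ≠ n₃ ∧
      (∀ a, (a, b) ∈ bonds (tube ℓ m lam₁ lam₂ μ) ↔ a = n₁ ∨ a = n₂ ∨ a = n₃) ∧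
      bondVec (m * μ) ((tube ℓ m lam₁ lam₂ μ).pos n₁) ((tube ℓ m lam₁ lam₂ μ).pos b)
        = displ (rho ℓ μ lam₁ lam₂) (axialSign b.2.2.2 * lam₁) (polarAngle b) 0 ∧
      bondVec (m * μ) ((tube ℓ m lam₁ lam₂ μ).pos n₂) ((tube ℓ m lam₁ lam₂ μ).pos b)
        = displ (rho ℓ μ lam₁ lam₂) (-axialSign b.2.2.2 * sigma μ lam₁) (polarAngle b) (π / ℓ) ∧
      bondVec (m * μ) ((tube ℓ m lam₁ lam₂ μ).pos n₃) ((tube ℓ m lam₁ lam₂ μ).pos b)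
        = displ (rho ℓ μ lam₁ lam₂) (-axialSign b.2.2.2 * sigma μ lam₁) (polarAngle b)
          (-(π / ℓ)) := by
  have hℓ0 : 0 < ℓ := by omega
  have hℓ' : (0 : ℝ) < ℓ := by exact_mod_cast hℓ0
  have hm' : (1 : ℝ) ≤ m := by exact_mod_cast hm
  have hL : 2.6 ≤ m * μ := by nlinarith [hμ.1]
  have hL0 : 0 < m * μ := lt_of_lt_of_le (by norm_num) hL
  obtain ⟨s1, s2⟩ := sigma_mem hμ h₁
  have hchord := chord_sq hℓ hμ h₁ h₂
  obtain ⟨i, j, k, l⟩ := b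
  -- The labels of the three neighbours, reduced modulo m along the axis and modulo ℓ around it.
  obtain ⟨j₁, t₁, hj₁⟩ := exists_fin_dvd_sub hm (((j : ℕ) : ℤ) + (2 * ((l : ℕ) : ℤ) - 1))
  obtain ⟨j₂, t₂, hj₂⟩ := exists_fin_dvd_sub hm (((j : ℕ) : ℤ) + (((k : ℕ) : ℤ) + (l : ℕ) - 1))
  obtain ⟨i₂, z₂, hi₂⟩ := exists_fin_dvd_sub hℓ0 (((i : ℕ) : ℤ) + (k : ℕ))
  obtain ⟨i₃, z₃, hi₃⟩ := exists_fin_dvd_sub hℓ0 (((i : ℕ) : ℤ) + (k : ℕ) - 1)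
  have hk1 : ((((1 - k : Fin 2) : ℕ)) : ℤ) = 1 - (k : ℕ) := by fin_cases k <;> simp
  have hlne : ∀ l : Fin 2, 1 - l ≠ l := by decide
  have hv₁ := tube_pos_sub (lam₁ := lam₁) (lam₂ := lam₂) (μ := μ) hℓ0 (i, j₁, k, 1 - l)
    (i, j, k, l) (q := 2 * ((l : ℕ) : ℤ) - 1) (d := 0) (t := t₁) (z := 0)
    (by simp only; linarith) (by simp)
  have hv₂ := tube_pos_sub (lam₁ := lam₁) (lam₂ := lam₂) (μ := μ) hℓ0 (i₂, j₂, 1 - k, 1 - l)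
    (i, j, k, l) (q := ((k : ℕ) : ℤ) + (l : ℕ) - 1) (d := 1) (t := t₂) (z := z₂)
    (by simp only; linarith) (by simp only [hk1]; linarith)
  have hv₃ := tube_pos_sub (lam₁ := lam₁) (lam₂ := lam₂) (μ := μ) hℓ0 (i₃, j₂, 1 - k, 1 - l)
    (i, j, k, l) (q := ((k : ℕ) : ℤ) + (l : ℕ) - 1) (d := -1) (t := t₂) (z := z₃)
    (by simp only; linarith) (by simp only [hk1]; linarith)
  simp only [axial_parallel, Int.cast_zero, mul_zero, zero_div] at hv₁
  simp only [axial_zigzag, Int.cast_one, mul_one] at hv₂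
  simp only [axial_zigzag, Int.cast_neg, Int.cast_one, mul_neg, mul_one, neg_div] at hv₃
  set T := tube ℓ m lam₁ lam₂ μ with hT
  have hper : T.period = m * μ := rfl
  have hlam₁ : (axialSign l * lam₁) ^ 2 < 1.1 ^ 2 := by
    rw [mul_pow, axialSign_sq, one_mul]
    exact pow_lt_pow_left₀ h₁.2 (lt_trans (by norm_num) h₁.1).le two_ne_zero
  have hlam₂ : lam₂ ^ 2 < 1.1 ^ 2 :=
    pow_lt_pow_left₀ h₂.2 (lt_trans (by norm_num) h₂.1).le two_ne_zero
  have hn₁ : ‖displ (rho ℓ μ lam₁ lam₂) (axialSign l * lam₁) (polarAngle (i, j, k, l)) 0‖ < 1.1 := by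
    refine lt_of_pow_lt_pow_left₀ 2 (by norm_num) ?_
    rw [norm_displ_sq]
    simpa using hlam₁
  have hn₂ : ‖displ (rho ℓ μ lam₁ lam₂) (-axialSign l * sigma μ lam₁) (polarAngle (i, j, k, l))
      (π / ℓ)‖ < 1.1 := by
    refine lt_of_pow_lt_pow_left₀ 2 (by norm_num) ?_
    rw [norm_displ_sq, mul_pow, neg_sq, axialSign_sq, one_mul, div_div, mul_comm (ℓ : ℝ), hchord]
    exact hlam₂
  have hn₃ : ‖displ (rho ℓ μ lam₁ lam₂) (-axialSign l * sigma μ lam₁) (polarAngle (i, j, k, l))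
      (-(π / ℓ))‖ < 1.1 := by
    refine lt_of_pow_lt_pow_left₀ 2 (by norm_num) ?_
    rw [norm_displ_sq, mul_pow, neg_sq, axialSign_sq, one_mul, neg_div, sin_neg, neg_sq, div_div,
      mul_comm (ℓ : ℝ), hchord]
    exact hlam₂
  rw [← hv₁] at hn₁
  rw [← hv₂] at hn₂
  rw [← hv₃] at hn₃
  refine ⟨(i, j₁, k, 1 - l), (i₂, j₂, 1 - k, 1 - l), (i₃, j₂, 1 - k, 1 - l), ?_, ?_, ?_, ?_,
    (bondVec_eq_of_norm_lt hL hn₁).trans hv₁, (bondVec_eq_of_norm_lt hL hn₂).trans hv₂,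
    (bondVec_eq_of_norm_lt hL hn₃).trans hv₃⟩
  · intro h
    simp only [Prod.mk.injEq] at h
    exact hlne k h.2.2.1.symm
  · intro h
    simp only [Prod.mk.injEq] at h
    exact hlne k h.2.2.1.symm
  · intro h
    simp only [Prod.mk.injEq] at h
    -- The two zigzag neighbours are adjacent in i; coincidence would force ℓ to divide 1.
    have h1 : (ℓ : ℤ) * (z₂ - z₃) = -1 := by rw [h.1] at hi₂; linarith
    have h2 := Int.isUnit_iff.1 (isUnit_of_dvd_one (Int.dvd_neg.1 ⟨_, h1.symm⟩))
    omega
  intro a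
  rw [mem_bonds, hper, distMod_lt_iff hL0]
  constructor
  · rintro ⟨hne, t, ht⟩
    obtain ⟨i', j', k', l'⟩ := a
    set q : ℤ := ((j' : ℕ) : ℤ) - (j : ℕ) - m * t with hq
    set d : ℤ := (2 * ((i' : ℕ) : ℤ) + (k' : ℕ)) - (2 * ((i : ℕ) : ℤ) + (k : ℕ)) with hd
    have hv := tube_pos_sub (lam₁ := lam₁) (lam₂ := lam₂) (μ := μ) hℓ0 (i', j', k', l')
      (i, j, k, l) (q := q) (d := d) (t := t) (z := 0) (by simp only [hq]; ring)
      (by simp only [hd]; ring)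
    rw [hv] at ht
    have hsq : ‖displ (rho ℓ μ lam₁ lam₂)
        (μ * q + axialOffset μ lam₁ k' l' - axialOffset μ lam₁ k l)
        (polarAngle (i, j, k, l)) (π * d / ℓ)‖ ^ 2 < 1.1 ^ 2 :=
      pow_lt_pow_left₀ ht (norm_nonneg _) two_ne_zero
    rw [norm_displ_sq, div_div, mul_comm (ℓ : ℝ)] at hsq
    have hlat0 : 0 ≤ 4 * rho ℓ μ lam₁ lam₂ ^ 2 * sin (π * d / (2 * ℓ)) ^ 2 := by positivity
    have hax : |μ * q + axialOffset μ lam₁ k' l' - axialOffset μ lam₁ k l| < 1.1 :=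
      abs_lt_of_sq_lt_sq (by linarith) (by norm_num)
    have hlat : ∃ z : ℤ, |d - 2 * ℓ * z| < 2 := by
      by_contra hcon
      push Not at hcon
      have := even_chord_sq_ge hℓ hμ h₁ h₂ hcon
      nlinarith [sq_nonneg (μ * q + axialOffset μ lam₁ k' l' - axialOffset μ lam₁ k l)]
    obtain ⟨z, hz⟩ := hlat
    obtain ⟨hz1, hz2⟩ := abs_lt.1 hz
    rw [mul_assoc] at hz1 hz2
    -- For k' = k the difference d is even, and the only even number at distance less than 2 from
    -- 2ℓz is 2ℓz itself.
    have heven : k' = k → i' = i := by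
      rintro rfl
      refine fin_eq_of_sub_eq_mul (t := z) ?_
      generalize (ℓ : ℤ) * z = w at *
      omega
    rcases axial_cases hμ h₁ hax with ⟨rfl, rfl, hq0⟩ | ⟨rfl, rfl, hq0⟩ | ⟨rfl, rfl, hq0⟩
    · have hjj : j' = j := fin_eq_of_sub_eq_mul (t := t) (by linarith)
      rw [heven rfl, hjj] at hne
      exact absurd rfl hne
    · have hjj : j' = j₁ := fin_eq_of_sub_eq_mul (t := t - t₁) (by linarith)
      left
      rw [heven rfl, hjj]
    · have hjj : j' = j₂ := fin_eq_of_sub_eq_mul (t := t - t₂) (by linarith)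
      right
      rw [hk1] at hd
      have hd1 : d = 1 + 2 * (ℓ * z) ∨ d = -1 + 2 * (ℓ * z) := by
        generalize (ℓ : ℤ) * z = w at *
        omega
      rcases hd1 with hd1 | hd1
      · left
        rw [hjj, show i' = i₂ from fin_eq_of_sub_eq_mul (t := z - z₂) (by linarith)]
      · right
        rw [hjj, show i' = i₃ from fin_eq_of_sub_eq_mul (t := z - z₃) (by linarith)]
  · have hne : ∀ (i' : Fin ℓ) (j' : Fin m) (k' : Fin 2), (i', j', k', 1 - l) ≠ (i, j, k, l) := by
      intro i' j' k' h
      simp only [Prod.mk.injEq] at h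
      exact hlne l h.2.2.2
    rintro (rfl | rfl | rfl)
    · exact ⟨hne _ _ _, t₁, hn₁⟩
    · exact ⟨hne _ _ _, t₂, hn₂⟩
    · exact ⟨hne _ _ _, t₂, hn₃⟩

theorem norm_bond_displ {ℓ : ℕ} (hℓ : 3 < ℓ) {μ lam₁ lam₂ : ℝ} (hμ : μ ∈ Set.Ioo 2.6 3.1)
    (h₁ : lam₁ ∈ Set.Ioo 0.9 1.1) (h₂ : lam₂ ∈ Set.Ioo 0.9 1.1) (θ : ℝ) (l : Fin 2) :
    ‖displ (rho ℓ μ lam₁ lam₂) (axialSign l * lam₁) θ 0‖ = lam₁ ∧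
      ‖displ (rho ℓ μ lam₁ lam₂) (-axialSign l * sigma μ lam₁) θ (π / ℓ)‖ = lam₂ ∧
      ‖displ (rho ℓ μ lam₁ lam₂) (-axialSign l * sigma μ lam₁) θ (-(π / ℓ))‖ = lam₂ := by
  have hp1 : 0 < lam₁ := lt_trans (by norm_num) h₁.1
  have hp2 : 0 < lam₂ := lt_trans (by norm_num) h₂.1
  have hchord := chord_sq hℓ hμ h₁ h₂
  refine ⟨(sq_eq_sq₀ (norm_nonneg _) hp1.le).1 ?_, (sq_eq_sq₀ (norm_nonneg _) hp2.le).1 ?_,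
    (sq_eq_sq₀ (norm_nonneg _) hp2.le).1 ?_⟩
  · rw [norm_displ_sq, mul_pow, axialSign_sq]
    simp
  · rw [norm_displ_sq, mul_pow, neg_sq, axialSign_sq, one_mul, div_div, mul_comm (ℓ : ℝ), hchord]
  · rw [norm_displ_sq, mul_pow, neg_sq, axialSign_sq, one_mul, neg_div, sin_neg, neg_sq, div_div,
      mul_comm (ℓ : ℝ), hchord]

theorem tube_period_pos {ℓ m : ℕ} (hm : 0 < m) {lam₁ lam₂ μ : ℝ} (hμ : 0 < μ) :
    0 < (tube ℓ m lam₁ lam₂ μ).period := by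
  have : (0 : ℝ) < m := by exact_mod_cast hm
  exact mul_pos this hμ

/-- The energy of a zigzag tube, in terms of its energy per atom. -/
theorem energy_tube {v₂ v₃ : ℝ → ℝ} {ℓ m : ℕ} (hℓ : 3 < ℓ) (hm : 0 < m) {μ lam₁ lam₂ : ℝ}
    (hμ : μ ∈ Set.Ioo 2.6 3.1) (h₁ : lam₁ ∈ Set.Ioo 0.9 1.1) (h₂ : lam₂ ∈ Set.Ioo 0.9 1.1) :
    energy v₂ v₃ (tube ℓ m lam₁ lam₂ μ)
      = 4 * m * ℓ * atomEnergy v₂ (fun x => v₃ (arccos x)) (1 - cos (π / ℓ)) μ (lam₁, lam₂) := by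
  have hp1 : 0 < lam₁ := lt_trans (by norm_num) h₁.1
  have hp2 : 0 < lam₂ := lt_trans (by norm_num) h₂.1
  have hchord : sigma μ lam₁ ^ 2 + 4 * rho ℓ μ lam₁ lam₂ ^ 2 * sin (π / ℓ / 2) ^ 2 = lam₂ ^ 2 := by
    rw [div_div, mul_comm (ℓ : ℝ)]
    exact chord_sq hℓ hμ h₁ h₂
  rw [sin_sq_eq_half_sub, mul_div_cancel₀ _ two_ne_zero] at hchord
  rw [energy_eq_of_three_bonds (A := v₂ lam₁) (B := v₂ lam₂)
    (P := v₃ (arccos (-((μ / 2 - lam₁) / lam₂))))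
    (Q := v₃ (arccos (2 * ((μ / 2 - lam₁) / lam₂) ^ 2 - 1
      + (1 - cos (π / ℓ)) * (1 - ((μ / 2 - lam₁) / lam₂) ^ 2))))
    (tube_period_pos hm (lt_trans (by norm_num) hμ.1))]
  · have hcard : Fintype.card (Label ℓ m) = ℓ * (m * (2 * 2)) := by simp [Label]
    rw [hcard]
    simp only [atomEnergy, angPot]
    push_cast
    ring
  intro b
  obtain ⟨n₁, n₂, n₃, h12, h13, h23, hn, e1, e2, e3⟩ := tube_neighbors hℓ hm hμ h₁ h₂ b
  obtain ⟨m1, m2, m3⟩ := norm_bond_displ hℓ hμ h₁ h₂ (polarAngle b) b.2.2.2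
  have hper : (tube ℓ m lam₁ lam₂ μ).period = m * μ := rfl
  refine ⟨n₁, n₂, n₃, h12, h13, h23, hn, ?_, ?_, ?_, ?_, ?_, ?_⟩
  · rw [distMod, hper, e1, m1]
  · rw [distMod, hper, e2, m2]
  · rw [distMod, hper, e3, m3]
  · rw [bondAngle, hper, e1, e2, InnerProductGeometry.angle, m1, m2, inner_displ]
    congr 2
    have := axialSign_sq b.2.2.2
    rw [zero_sub, cos_neg, cos_zero]
    change _ = -(sigma μ lam₁ / lam₂)
    field_simp
    linear_combination -sigma μ lam₁ * lam₁ * this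
  · rw [bondAngle, hper, e1, e3, InnerProductGeometry.angle, m1, m3, inner_displ]
    congr 2
    have := axialSign_sq b.2.2.2
    rw [zero_sub, neg_neg, cos_neg, cos_zero]
    change _ = -(sigma μ lam₁ / lam₂)
    field_simp
    linear_combination -sigma μ lam₁ * lam₁ * this
  -- With C = cos(π/ℓ) the inner product is σ² - 2ρ²C(1 - C), and the chord relation 2ρ²(1 - C) =
  -- λ₂² - σ² eliminates ρ: the cosine is t² - C(1 - t²).
  · rw [bondAngle, hper, e2, e3, InnerProductGeometry.angle, m2, m3, inner_displ]
    congr 2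
    have := axialSign_sq b.2.2.2
    rw [cos_neg, sub_neg_eq_add, ← two_mul, cos_two_mul]
    change _ = 2 * (sigma μ lam₁ / lam₂) ^ 2 - 1
      + (1 - cos (π / ℓ)) * (1 - (sigma μ lam₁ / lam₂) ^ 2)
    field_simp
    linear_combination sigma μ lam₁ ^ 2 * this - cos (π / ℓ) * hchord

/-! ### The energy of cleaved tubes -/

theorem tube_bond_length {ℓ m : ℕ} (hℓ : 3 < ℓ) (hm : 0 < m) {μ : ℝ} (hμ : μ ∈ Set.Ioo 2.6 3.1)
    {a b : Label ℓ m} (h : (a, b) ∈ bonds (tube ℓ m 1 1 μ)) :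
    distMod (m * μ) ((tube ℓ m 1 1 μ).pos a) ((tube ℓ m 1 1 μ).pos b) = 1 := by
  have h1 : (1 : ℝ) ∈ Set.Ioo 0.9 1.1 := by constructor <;> norm_num
  obtain ⟨n₁, n₂, n₃, -, -, -, hn, e1, e2, e3⟩ := tube_neighbors hℓ hm hμ h1 h1 b
  obtain ⟨m1, m2, m3⟩ := norm_bond_displ hℓ hμ h1 h1 (polarAngle b) b.2.2.2
  rcases (hn a).1 h with rfl | rfl | rfl
  · rw [distMod, e1, m1]
  · rw [distMod, e2, m2]
  · rw [distMod, e3, m3]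

/-- Removing bonds of optimal length costs at most `1 / 2` for each ordered pair. -/
theorem energy_le_of_bonds_subset {v₂ v₃ : ℝ → ℝ} (h₃ : ∀ x ∈ Set.Icc 0 π, 0 ≤ v₃ x)
    {ι : Type} [Fintype ι] [DecidableEq ι] {C T : Config ι} (hC : 0 < C.period)
    (hT : ∀ p ∈ bonds T, v₂ (distMod T.period (T.pos p.1) (T.pos p.2)) = -1)
    (h : ∀ a b, (a, b) ∈ bonds C → (a, b) ∈ bonds T ∧
      bondVec C.period (C.pos a) (C.pos b) = bondVec T.period (T.pos a) (T.pos b)) :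
    energy v₂ v₃ C ≤ energy v₂ v₃ T + 1 / 2 * (bonds T \ bonds C).card := by
  have hsub : bonds C ⊆ bonds T := fun p hp => (h p.1 p.2 hp).1
  have htri : triples C ⊆ triples T := by
    intro t ht
    simp only [triples, Finset.mem_filter, Finset.mem_univ, true_and] at ht ⊢
    exact ⟨ht.1, hsub ht.2.1, hsub ht.2.2⟩
  have s1 : ∑ p ∈ bonds C, v₂ (distMod C.period (C.pos p.1) (C.pos p.2)) = -(bonds C).card := by
    rw [Finset.sum_congr rfl (g := fun _ => (-1 : ℝ))]
    · simp
    · intro p hp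
      rw [distMod, (h p.1 p.2 hp).2, ← distMod, hT p (hsub hp)]
  have s2 : ∑ p ∈ bonds T, v₂ (distMod T.period (T.pos p.1) (T.pos p.2)) = -(bonds T).card := by
    rw [Finset.sum_congr rfl hT]
    simp
  -- Surviving angles are unchanged and the lost ones had nonnegative energy, so the three-body part
  -- does not increase.
  have s3 : ∑ t ∈ triples C, v₃ (bondAngle C t.1 t.2.1 t.2.2)
      ≤ ∑ t ∈ triples T, v₃ (bondAngle T t.1 t.2.1 t.2.2) := by
    calc _ = ∑ t ∈ triples C, v₃ (bondAngle T t.1 t.2.1 t.2.2) := by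
          refine Finset.sum_congr rfl fun t ht => ?_
          simp only [triples, Finset.mem_filter, Finset.mem_univ, true_and] at ht
          rw [bondAngle, bondAngle, (h _ _ ht.2.1).2, (h _ _ ((mem_bonds_comm hC).1 ht.2.2)).2]
      _ ≤ _ := Finset.sum_le_sum_of_subset_of_nonneg htri fun t _ _ =>
          h₃ _ ⟨InnerProductGeometry.angle_nonneg _ _, InnerProductGeometry.angle_le_pi _ _⟩
  have hcard : ((bonds T \ bonds C).card : ℝ) + (bonds C).card = (bonds T).card := by
    exact_mod_cast Finset.card_sdiff_add_card_eq_card hsub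
  rw [energy, energy, s1, s2]
  linarith

/-- The translation applied to an atom of the cleaved tube. -/
noncomputable def cleaveShift {ℓ m : ℕ} (d : ℝ) (a : Label ℓ m) : ℝ :=
  if ((a.2.1 : ℕ) : ℝ) < (m : ℝ) / 2 then 0 else d

theorem cleaved_pos {ℓ m : ℕ} {μ₀ μ : ℝ} (a : Label ℓ m) :
    (cleaved ℓ m μ₀ μ).pos a
      = (tube ℓ m 1 1 μ₀).pos a + (cleaveShift (m * (μ - μ₀)) a) • e₁ := by
  unfold cleaved cleaveShift
  simp only
  split_ifs <;> simp

theorem tube_pos_axial {ℓ m : ℕ} {μ lam₁ lam₂ : ℝ} (a : Label ℓ m) :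
    (tube ℓ m lam₁ lam₂ μ).pos a 0
      = μ * (a.2.1 : ℕ) + axialOffset μ lam₁ a.2.2.1 a.2.2.2 := by
  simp [tube, atom, axialOffset, sigma]
  ring

theorem axialOffset_mem {μ : ℝ} (hμ : μ ∈ Set.Ioo 2.6 3.1) (k l : Fin 2) :
    0 ≤ axialOffset μ 1 k l ∧ axialOffset μ 1 k l ≤ μ + 0.65 := by
  obtain ⟨s1, s2⟩ := sigma_mem hμ (lam₁ := 1) (by constructor <;> norm_num)
  have hμs : μ = 2 * sigma μ 1 + 2 := by unfold sigma; ring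
  norm_num at s1 s2 ⊢
  fin_cases k <;> fin_cases l <;> simp [axialOffset] <;> (try constructor) <;> linarith

/-! ### Which bonds survive the cut -/

section
variable {ℓ m : ℕ} {μ₀ d : ℝ}

theorem int_eq_zero_of_abs_sub_lt {X P : ℝ} {t : ℤ} (hP : 0 < P) (h : |X - P * t| < P - |X|) :
    t = 0 := by
  obtain ⟨h1, h2⟩ := abs_lt.1 h
  have e1 := le_abs_self X
  have e2 := neg_abs_le X
  have h3 : (-1 : ℝ) < t := by nlinarith
  have h4 : (t : ℝ) < 1 := by nlinarith
  have h3' : -1 < t := by exact_mod_cast h3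
  have h4' : t < 1 := by exact_mod_cast h4
  omega

/-- Sufficiently close atoms of the cleaved tube have the same distance in the original tube. -/
theorem cleaved_close (hμ : μ₀ ∈ Set.Ioo 2.6 3.1) (hd : 10 ≤ d) (a b : Label ℓ m) {t : ℤ}
    (h : |(tube ℓ m 1 1 μ₀).pos a 0 + cleaveShift d a
      - ((tube ℓ m 1 1 μ₀).pos b 0 + cleaveShift d b) - (m * μ₀ + d) * t| < 1.1) :
    ∃ s : ℤ, cleaveShift d a - cleaveShift d b - (m * μ₀ + d) * t = -(m * μ₀ * s) := by
  rw [tube_pos_axial, tube_pos_axial] at h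
  obtain ⟨o1, o2⟩ := axialOffset_mem hμ a.2.2.1 a.2.2.2
  obtain ⟨o3, o4⟩ := axialOffset_mem hμ b.2.2.1 b.2.2.2
  have ha : ((a.2.1 : ℕ) : ℝ) + 1 ≤ m := by exact_mod_cast a.2.1.2
  have hb : ((b.2.1 : ℕ) : ℝ) + 1 ≤ m := by exact_mod_cast b.2.1.2
  have ha0 : (0 : ℝ) ≤ (a.2.1 : ℕ) := Nat.cast_nonneg _
  have hb0 : (0 : ℝ) ≤ (b.2.1 : ℕ) := Nat.cast_nonneg _
  have hμ0 : 0 < μ₀ := lt_trans (by norm_num) hμ.1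
  have g1 := mul_le_mul_of_nonneg_left ha hμ0.le
  have g2 := mul_le_mul_of_nonneg_left hb hμ0.le
  have g3 := mul_nonneg hμ0.le ha0
  have g4 := mul_nonneg hμ0.le hb0
  have hm0 : 0 < m * μ₀ := mul_pos (by linarith) hμ0
  norm_num at h o2 o4
  have horder : ∀ i j : Fin m, ((i : ℕ) : ℝ) < (j : ℕ) →
      μ₀ * (i : ℕ) + μ₀ ≤ μ₀ * (j : ℕ) := by
    intro i j hij
    have : ((i : ℕ) : ℝ) + 1 ≤ (j : ℕ) := by exact_mod_cast hij
    nlinarith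
  by_cases h1 : ((a.2.1 : ℕ) : ℝ) < (m : ℝ) / 2 <;> by_cases h2 : ((b.2.1 : ℕ) : ℝ) < (m : ℝ) / 2
  · simp only [cleaveShift, h1, h2, if_true, add_zero, sub_zero] at h ⊢
    have ht := int_eq_zero_of_abs_sub_lt (by linarith : 0 < m * μ₀ + d) (h.trans_le (by
      rw [le_sub_comm, abs_le]
      constructor <;> linarith))
    exact ⟨0, by simp [ht]⟩
  · simp only [cleaveShift, h1, h2, if_true, if_false, add_zero, zero_sub] at h ⊢
    have g5 := horder _ _ (h1.trans_le (not_lt.1 h2))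
    -- The gap d ≥ 10 excludes contact across the cut. What remains is contact through the end of
    -- the period, where the shift d cancels the added period.
    have ht : t + 1 = 0 := by
      refine int_eq_zero_of_abs_sub_lt (P := m * μ₀ + d)
        (X := m * μ₀ + (μ₀ * (a.2.1 : ℕ) + axialOffset μ₀ 1 a.2.2.1 a.2.2.2)
          - (μ₀ * (b.2.1 : ℕ) + axialOffset μ₀ 1 b.2.2.1 b.2.2.2)) (by linarith) ?_
      rw [show ∀ A B : ℝ, m * μ₀ + A - B - (m * μ₀ + d) * ((t + 1 : ℤ) : ℝ)
        = A - (B + d) - (m * μ₀ + d) * t by intros; push_cast; ring]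
      refine h.trans_le ?_
      rw [le_sub_comm, abs_le]
      constructor <;> linarith
    refine ⟨-1, ?_⟩
    rw [show t = -1 by omega]
    push_cast
    ring
  · simp only [cleaveShift, h1, h2, if_true, if_false, add_zero, sub_zero] at h ⊢
    have g5 := horder _ _ (h2.trans_le (not_lt.1 h1))
    have ht : t - 1 = 0 := by
      refine int_eq_zero_of_abs_sub_lt (P := m * μ₀ + d)
        (X := (μ₀ * (a.2.1 : ℕ) + axialOffset μ₀ 1 a.2.2.1 a.2.2.2)
          - (μ₀ * (b.2.1 : ℕ) + axialOffset μ₀ 1 b.2.2.1 b.2.2.2) - m * μ₀) (by linarith) ?_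
      rw [show ∀ A B : ℝ, A - B - m * μ₀ - (m * μ₀ + d) * ((t - 1 : ℤ) : ℝ)
        = A + d - B - (m * μ₀ + d) * t by intros; push_cast; ring]
      refine h.trans_le ?_
      rw [le_sub_comm, abs_le]
      constructor <;> linarith
    refine ⟨1, ?_⟩
    rw [show t = 1 by omega]
    push_cast
    ring
  · simp only [cleaveShift, h1, h2, if_false, add_sub_add_right_eq_sub, sub_self, zero_sub] at h ⊢
    have ht := int_eq_zero_of_abs_sub_lt (by linarith : 0 < m * μ₀ + d) (h.trans_le (by
      rw [le_sub_comm, abs_le]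
      constructor <;> linarith))
    exact ⟨0, by simp [ht]⟩

/-- Only bonds near the cut are lost by cleaving. -/
theorem cleaved_keeps (hμ : μ₀ ∈ Set.Ioo 2.6 3.1) (hm : 3 ≤ m) (a b : Label ℓ m) {t : ℤ}
    (h : |(tube ℓ m 1 1 μ₀).pos a 0 - (tube ℓ m 1 1 μ₀).pos b 0 - m * μ₀ * t| < 1.1) :
    (∃ s : ℤ, cleaveShift d a - cleaveShift d b - (m * μ₀ + d) * s = -(m * μ₀ * t)) ∨
      (b.2.1 : ℕ) + 1 = (m + 1) / 2 ∨ (b.2.1 : ℕ) = (m + 1) / 2 := by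
  rw [tube_pos_axial, tube_pos_axial] at h
  obtain ⟨o1, o2⟩ := axialOffset_mem hμ a.2.2.1 a.2.2.2
  obtain ⟨o3, o4⟩ := axialOffset_mem hμ b.2.2.1 b.2.2.2
  have ha : ((a.2.1 : ℕ) : ℝ) + 1 ≤ m := by exact_mod_cast a.2.1.2
  have hb : ((b.2.1 : ℕ) : ℝ) + 1 ≤ m := by exact_mod_cast b.2.1.2
  have ha0 : (0 : ℝ) ≤ (a.2.1 : ℕ) := Nat.cast_nonneg _
  have hb0 : (0 : ℝ) ≤ (b.2.1 : ℕ) := Nat.cast_nonneg _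
  obtain ⟨m1, m2⟩ := hμ
  norm_num at m1 m2 h o2 o4
  have hμ0 : 0 < μ₀ := by linarith
  have hm3 : (3 : ℝ) ≤ m := by exact_mod_cast hm
  have hlarge : 7.8 ≤ m * μ₀ := by norm_num; nlinarith
  norm_num at hlarge
  -- Indices on the same side of the cut differ by at most (m - 1)/2, so for m ≥ 3 such atoms cannot
  -- meet by going around the period.
  have hsame : ∀ i j : Fin m, (((i : ℕ) : ℝ) < (m : ℝ) / 2 ↔ ((j : ℕ) : ℝ) < (m : ℝ) / 2) →
      μ₀ * (i : ℕ) - μ₀ * (j : ℕ) ≤ (m * μ₀ - μ₀) / 2 := by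
    intro i j hij
    have hi := i.2
    have hij' : 2 * (i : ℕ) < m ↔ 2 * (j : ℕ) < m := by
      rw [lt_div_iff₀ two_pos, lt_div_iff₀ two_pos] at hij
      rw [mul_comm, mul_comm 2 (j : ℕ)]
      exact_mod_cast hij
    have : 2 * (i : ℕ) + 1 ≤ m + 2 * (j : ℕ) := by omega
    have : 2 * ((i : ℕ) : ℝ) + 1 ≤ m + 2 * (j : ℕ) := by exact_mod_cast this
    nlinarith
  have g1 := mul_le_mul_of_nonneg_left ha hμ0.le
  have g2 := mul_le_mul_of_nonneg_left hb hμ0.le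
  have g3 := mul_nonneg hμ0.le ha0
  have g4 := mul_nonneg hμ0.le hb0
  have hm1 : 2 * μ₀ ≤ m * μ₀ - μ₀ := by nlinarith
  have hzero : (((a.2.1 : ℕ) : ℝ) < (m : ℝ) / 2 ↔ ((b.2.1 : ℕ) : ℝ) < (m : ℝ) / 2) → t = 0 := by
    intro hiff
    have q1 := hsame _ _ hiff
    have q2 := hsame _ _ hiff.symm
    refine int_eq_zero_of_abs_sub_lt (by linarith : 0 < m * μ₀) (h.trans_le ?_)
    rw [le_sub_comm, abs_le]
    constructor <;> linarith
  -- Atoms close to each other across the cut lie in adjacent minimal periods; (m + 1)/2 in integer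
  -- division is ⌈m/2⌉, the first shifted index.
  have hnext : ∀ (i j : Fin m) (x y : ℝ), ((j : ℕ) : ℝ) < (m : ℝ) / 2 →
      (m : ℝ) / 2 ≤ (i : ℕ) → 0 ≤ x → y ≤ μ₀ + 13 / 20 →
      μ₀ * (i : ℕ) + x - (μ₀ * (j : ℕ) + y) < 11 / 10 →
      (i : ℕ) = (m + 1) / 2 ∧ (j : ℕ) + 1 = (m + 1) / 2 := by
    intro i j x y hj hi hx hy hlt
    have h1 : ((i : ℕ) : ℝ) < (j : ℕ) + 2 := by
      by_contra hcon
      nlinarith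
    have h1' : (i : ℕ) < (j : ℕ) + 2 := by exact_mod_cast h1
    have h2 : 2 * (j : ℕ) < m := by
      rw [lt_div_iff₀ two_pos] at hj
      rw [mul_comm]
      exact_mod_cast hj
    have h3 : m ≤ 2 * (i : ℕ) := by
      rw [div_le_iff₀ two_pos] at hi
      rw [mul_comm]
      exact_mod_cast hi
    omega
  have horder : ∀ i j : Fin m, ((i : ℕ) : ℝ) < (j : ℕ) →
      μ₀ * (i : ℕ) + μ₀ ≤ μ₀ * (j : ℕ) := by
    intro i j hij
    have : ((i : ℕ) : ℝ) + 1 ≤ (j : ℕ) := by exact_mod_cast hij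
    nlinarith
  obtain ⟨r1, r2⟩ := abs_lt.1 h
  have hP : 0 < m * μ₀ := by linarith
  by_cases h1 : ((a.2.1 : ℕ) : ℝ) < (m : ℝ) / 2 <;> by_cases h2 : ((b.2.1 : ℕ) : ℝ) < (m : ℝ) / 2
  · refine Or.inl ⟨0, ?_⟩
    simp [cleaveShift, h1, h2, hzero (by simp [h1, h2])]
  · have g5 := horder _ _ (h1.trans_le (not_lt.1 h2))
    have t1 : (-2 : ℝ) < t := lt_of_mul_lt_mul_left (by linarith) hP.le
    have t2 : (t : ℝ) < 1 := lt_of_mul_lt_mul_left (by linarith) hP.le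
    have t1' : -2 < t := by exact_mod_cast t1
    have t2' : t < 1 := by exact_mod_cast t2
    obtain rfl | rfl : t = -1 ∨ t = 0 := by omega
    · refine Or.inl ⟨-1, ?_⟩
      simp only [cleaveShift, h1, h2, if_true, if_false]
      push_cast
      ring
    · right; right
      refine (hnext _ _ _ _ h1 (not_lt.1 h2) o3 o2 ?_).1
      simp only [Int.cast_zero, mul_zero, sub_zero] at r1
      linarith
  · have g5 := horder _ _ (h2.trans_le (not_lt.1 h1))
    have t1 : (-1 : ℝ) < t := lt_of_mul_lt_mul_left (by linarith) hP.le
    have t2 : (t : ℝ) < 2 := lt_of_mul_lt_mul_left (by linarith) hP.le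
    have t1' : -1 < t := by exact_mod_cast t1
    have t2' : t < 2 := by exact_mod_cast t2
    obtain rfl | rfl : t = 1 ∨ t = 0 := by omega
    · refine Or.inl ⟨1, ?_⟩
      simp only [cleaveShift, h1, h2, if_true, if_false]
      push_cast
      ring
    · right; left
      refine (hnext _ _ _ _ h2 (not_lt.1 h1) o1 o4 ?_).2
      simp only [Int.cast_zero, mul_zero, sub_zero] at r2
      linarith
  · refine Or.inl ⟨0, ?_⟩
    simp [cleaveShift, h1, h2, hzero (by simp [h1, h2])]

end

theorem card_near_cut_le (ℓ m J : ℕ) :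
    (Finset.univ.filter fun b : Label ℓ m => (b.2.1 : ℕ) + 1 = J ∨ (b.2.1 : ℕ) = J).card
      ≤ 8 * ℓ := by
  have hj : (Finset.univ.filter fun j : Fin m => (j : ℕ) + 1 = J ∨ (j : ℕ) = J).card ≤ 2 := by
    refine (Finset.card_le_card_of_injOn (t := ({J - 1, J} : Finset ℕ)) Fin.val ?_
      Fin.val_injective.injOn).trans Finset.card_le_two
    intro j hj
    simp only [Finset.coe_filter, Finset.mem_univ, true_and, Set.mem_ofPred_eq] at hj
    simp only [Finset.coe_insert, Finset.coe_singleton, Set.mem_insert_iff, Set.mem_singleton_iff]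
    omega
  have hsub : (Finset.univ.filter fun b : Label ℓ m => (b.2.1 : ℕ) + 1 = J ∨ (b.2.1 : ℕ) = J)
      ⊆ (Finset.univ : Finset (Fin ℓ)) ×ˢ
        (Finset.univ.filter fun j : Fin m => (j : ℕ) + 1 = J ∨ (j : ℕ) = J) ×ˢ
        (Finset.univ : Finset (Fin 2 × Fin 2)) := by
    intro b hb
    simpa using hb
  refine (Finset.card_le_card hsub).trans ?_
  rw [Finset.card_product, Finset.card_product]
  simp only [Finset.card_univ, Fintype.card_prod, Fintype.card_fin]
  nlinarith [Nat.mul_le_mul_left ℓ hj]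

/-- The cost of cleaving a tube is bounded independently of its length. -/
theorem energy_cleaved_le {v₂ v₃ : ℝ → ℝ} (h₂ : v₂ 1 = -1) (h₃ : ∀ x ∈ Set.Icc 0 π, 0 ≤ v₃ x)
    {ℓ m : ℕ} (hℓ : 3 < ℓ) (hm : 3 ≤ m) {μ₀ μ : ℝ} (hμ₀ : μ₀ ∈ Set.Ioo 2.6 3.1)
    (hμ : 10 ≤ m * (μ - μ₀)) :
    energy v₂ v₃ (cleaved ℓ m μ₀ μ) ≤ energy v₂ v₃ (tube ℓ m 1 1 μ₀) + 12 * ℓ := by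
  have h1 : (1 : ℝ) ∈ Set.Ioo 0.9 1.1 := by constructor <;> norm_num
  have hm' : (1 : ℝ) ≤ m := by exact_mod_cast (by omega : 1 ≤ m)
  set d := m * (μ - μ₀) with hd
  have hL : 2.6 ≤ m * μ₀ := by nlinarith [hμ₀.1]
  have hperC : (cleaved ℓ m μ₀ μ).period = m * μ₀ + d := by
    show (m : ℝ) * μ = _
    rw [hd]
    ring
  have hL0 : 0 < m * μ₀ := lt_of_lt_of_le (by norm_num) hL
  have hL' : 2.6 ≤ m * μ₀ + d := by linarith
  have hL0' : 0 < m * μ₀ + d := by linarith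
  have hvec : ∀ (a b : Label ℓ m) (s t : ℤ),
      cleaveShift d a - cleaveShift d b - (m * μ₀ + d) * t = -(m * μ₀ * s) →
      (cleaved ℓ m μ₀ μ).pos a - (cleaved ℓ m μ₀ μ).pos b - ((m * μ₀ + d) * t) • e₁
        = (tube ℓ m 1 1 μ₀).pos a - (tube ℓ m 1 1 μ₀).pos b - (m * μ₀ * s) • e₁ := by
    intro a b s t hst
    rw [cleaved_pos, cleaved_pos, ← hd]
    have : (cleaveShift d a - cleaveShift d b - (m * μ₀ + d) * t) • e₁ = (-(m * μ₀ * s)) • e₁ := by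
      rw [hst]
    rw [sub_smul, sub_smul, neg_smul] at this
    rw [sub_eq_add_neg _ ((m * μ₀ * s : ℝ) • e₁), ← this]
    abel
  have hkeep : ∀ a b, (a, b) ∈ bonds (cleaved ℓ m μ₀ μ) → (a, b) ∈ bonds (tube ℓ m 1 1 μ₀) ∧
      bondVec (cleaved ℓ m μ₀ μ).period ((cleaved ℓ m μ₀ μ).pos a) ((cleaved ℓ m μ₀ μ).pos b)
        = bondVec (tube ℓ m 1 1 μ₀).period ((tube ℓ m 1 1 μ₀).pos a)
          ((tube ℓ m 1 1 μ₀).pos b) := by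
    intro a b hab
    rw [mem_bonds, hperC, distMod_lt_iff hL0'] at hab
    obtain ⟨hne, t, ht⟩ := hab
    have hax := (abs_axis_le_norm _ _ _).trans_lt ht
    rw [cleaved_pos, cleaved_pos, ← hd] at hax
    obtain ⟨s, hs⟩ := cleaved_close (t := t) hμ₀ hμ a b (by simpa [e₁] using hax)
    have hv := hvec a b s t hs
    have ht' := ht
    rw [hv] at ht'
    refine ⟨mem_bonds.2 ⟨hne, (distMod_lt_iff hL0).2 ⟨s, ht'⟩⟩, ?_⟩
    rw [hperC, bondVec_eq_of_norm_lt hL' ht, hv]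
    exact (bondVec_eq_of_norm_lt hL ht').symm
  -- The second atom of a lost pair is one of at most 8ℓ atoms next to the cut and has three
  -- neighbours in the tube. The 24ℓ ordered pairs at 1/2 each give the cost 12ℓ.
  have hlost : (bonds (tube ℓ m 1 1 μ₀) \ bonds (cleaved ℓ m μ₀ μ)).card ≤ 3 * (8 * ℓ) := by
    refine (Finset.card_le_mul_card_image_of_maps_to (f := Prod.snd)
      (t := Finset.univ.filter fun b : Label ℓ m =>
        (b.2.1 : ℕ) + 1 = (m + 1) / 2 ∨ (b.2.1 : ℕ) = (m + 1) / 2) ?_ 3 ?_).trans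
      (Nat.mul_le_mul_left 3 (card_near_cut_le ℓ m _))
    · rintro ⟨a, b⟩ hab
      rw [Finset.mem_sdiff, mem_bonds, mem_bonds, hperC] at hab
      obtain ⟨⟨hne, hT⟩, hC⟩ := hab
      obtain ⟨t, ht⟩ := (distMod_lt_iff hL0).1 hT
      rcases cleaved_keeps (d := d) hμ₀ hm a b ((abs_axis_le_norm _ _ _).trans_lt ht) with
        ⟨s, hs⟩ | hnear
      · refine absurd ⟨hne, (distMod_lt_iff hL0').2 ⟨s, ?_⟩⟩ hC
        rwa [hvec a b t s hs]
      · simpa using hnear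
    · intro b _
      obtain ⟨n₁, n₂, n₃, -, -, -, hn, -⟩ := tube_neighbors hℓ (by omega : 0 < m) hμ₀ h1 h1 b
      refine (Finset.card_le_card (t := {(n₁, b), (n₂, b), (n₃, b)}) ?_).trans Finset.card_le_three
      rintro ⟨a, b'⟩ hab
      rw [Finset.mem_filter, Finset.mem_sdiff] at hab
      obtain ⟨⟨hT, -⟩, rfl⟩ := hab
      have := (hn a).1 hT
      simp only [Finset.mem_insert, Finset.mem_singleton, Prod.mk.injEq, and_true]
      exact this
  have hmain := energy_le_of_bonds_subset (v₂ := v₂) h₃ (hperC ▸ hL0')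
    (T := tube ℓ m 1 1 μ₀) (fun p hp => by
      rw [show (tube ℓ m 1 1 μ₀).period = m * μ₀ from rfl,
        tube_bond_length hℓ (by omega : 0 < m) hμ₀ hp, h₂]) hkeep
  have hlost' : ((bonds (tube ℓ m 1 1 μ₀) \ bonds (cleaved ℓ m μ₀ μ)).card : ℝ) ≤ 3 * (8 * ℓ) := by
    exact_mod_cast hlost
  linarith

/-! ### Bond angles of unstretched tubes -/

theorem cos_pi_div_lt_one {ℓ : ℕ} (hℓ : 3 < ℓ) : cos (π / ℓ) < 1 := by
  have hℓ' : (3 : ℝ) < ℓ := by exact_mod_cast hℓ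
  have h : π / ℓ ≤ π := div_le_self pi_pos.le (by linarith)
  have := cos_lt_cos_of_nonneg_of_le_pi le_rfl h (by have := pi_pos; positivity : 0 < π / ℓ)
  rwa [cos_zero] at this

theorem one_sub_cos_pi_div_lt {ε : ℝ} (hε : 0 < ε) {ℓ : ℕ} (hℓ : 0 < ℓ) (h : 8 / ε < ℓ) :
    1 - cos (π / ℓ) < ε := by
  have hℓ' : (1 : ℝ) ≤ ℓ := by exact_mod_cast hℓ
  have h1 := one_sub_sq_div_two_le_cos (x := π / ℓ)
  have h2 : (π / ℓ) ^ 2 / 2 < 8 / ℓ := by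
    rw [div_pow, div_div, div_lt_div_iff₀ (by positivity) (by positivity)]
    have h3 : π ^ 2 < 16 := by nlinarith [pi_lt_four, pi_pos]
    nlinarith
  have h3 : 8 / (ℓ : ℝ) < ε := by
    rw [div_lt_iff₀ hε] at h
    rw [div_lt_iff₀ (by linarith)]
    linarith
  linarith

theorem beta_mem_Icc (a g : ℝ) (h : 0 ≤ sin a * sin (g / 2)) : beta a g ∈ Set.Icc 0 π := by
  unfold beta
  constructor
  · linarith [arcsin_nonneg.2 h]
  · linarith [arcsin_le_pi_div_two (sin a * sin (g / 2))]

theorem sin_gam_half {ℓ : ℕ} : sin (gam ℓ / 2) = cos (π / ℓ / 2) := by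
  unfold gam
  rw [← sin_pi_div_two_sub]
  congr 1
  ring

/-- Taking cosines, the equation becomes 1 - cos a = (1 - cos² a)(1 + cos(π/ℓ)). The factor 1 - cos
a is nonzero on (0, π), and cancelling it leaves a linear equation for cos a. -/
theorem beta_eq_self_iff {ℓ : ℕ} (hℓ : 3 < ℓ) {a : ℝ} (ha : a ∈ Set.Ioo 0 π) :
    beta a (gam ℓ) = a ↔ -cos a = (1 - (1 - cos (π / ℓ))) / (2 - (1 - cos (π / ℓ))) := by
  have hℓ' : (3 : ℝ) < ℓ := by exact_mod_cast hℓ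
  have hx0 : 0 ≤ π / ℓ := by have := pi_pos; positivity
  have hx : π / ℓ ≤ π := div_le_self pi_pos.le (by linarith)
  have hsin : 0 < sin a := sin_pos_of_pos_of_lt_pi ha.1 ha.2
  have hc : 0 ≤ cos (π / ℓ / 2) := cos_nonneg_of_mem_Icc ⟨by linarith, by linarith⟩
  have hu0 : 0 ≤ sin a * sin (gam ℓ / 2) := by
    rw [sin_gam_half]
    exact mul_nonneg hsin.le hc
  have hu1 : sin a * sin (gam ℓ / 2) ≤ 1 :=
    mul_le_one₀ (sin_le_one _) (by rw [sin_gam_half]; exact hc) (sin_le_one _)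
  have hcos : cos (beta a (gam ℓ)) = 1 - (1 - cos a ^ 2) * (1 + cos (π / ℓ)) := by
    unfold beta
    rw [cos_two_mul, cos_sq', sin_arcsin (by linarith) hu1, mul_pow, sin_gam_half, sin_sq,
      cos_sq (π / ℓ / 2), mul_div_cancel₀ _ two_ne_zero]
    ring
  have hden : 0 < 1 + cos (π / ℓ) := by
    have h1 := cos_lt_cos_of_nonneg_of_le_pi hx0 le_rfl (div_lt_self pi_pos (by linarith))
    rw [cos_pi] at h1
    linarith
  have hca : -1 < cos a := by
    have h1 := cos_lt_cos_of_nonneg_of_le_pi ha.1.le le_rfl ha.2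
    rwa [cos_pi] at h1
  rw [← (injOn_cos.eq_iff (beta_mem_Icc _ _ hu0) (Set.Ioo_subset_Icc_self ha)), hcos,
    eq_div_iff (by linarith)]
  have hne : cos a - 1 ≠ 0 := by
    have h1 := cos_lt_cos_of_nonneg_of_le_pi le_rfl ha.2.le ha.1
    rw [cos_zero] at h1
    linarith
  constructor
  · intro h
    refine mul_left_cancel₀ hne ?_
    linear_combination -h
  · intro h
    linear_combination (1 - cos a) * h

theorem neg_cos_mem_of_mem {s t a : ℝ} (hs : -1 ≤ -s) (hs' : -s ≤ 1) (ht : -1 ≤ -t) (ht' : -t ≤ 1)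
    (ha : a ∈ Set.Ioo (arccos (-s)) (arccos (-t))) :
    a ∈ Set.Ioo 0 π ∧ s < -cos a ∧ -cos a < t := by
  have h0 : 0 < a := (arccos_nonneg _).trans_lt ha.1
  have h1 : a < π := ha.2.trans_le (arccos_le_pi _)
  have h2 := cos_lt_cos_of_nonneg_of_le_pi (arccos_nonneg _) h1.le ha.1
  have h3 := cos_lt_cos_of_nonneg_of_le_pi h0.le (arccos_le_pi _) ha.2
  rw [cos_arccos hs hs'] at h2
  rw [cos_arccos ht ht'] at h3
  exact ⟨⟨h0, h1⟩, by linarith, by linarith⟩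

theorem isEqualAngle_arccos {ℓ : ℕ} (hℓ : 3 < ℓ) {ε : ℝ} (hε : ε = 1 - cos (π / ℓ))
    (h1 : 0.4 < (1 - ε) / (2 - ε)) (h2 : (1 - ε) / (2 - ε) < 0.6) :
    IsEqualAngle ℓ (arccos (-((1 - ε) / (2 - ε)))) := by
  set t := (1 - ε) / (2 - ε) with ht
  norm_num at h1 h2
  have hmem : arccos (-t) ∈ Set.Ioo (arccos (-0.4)) (arccos (-0.6)) :=
    ⟨arccos_lt_arccos (by linarith) (by norm_num; linarith) (by norm_num),
      arccos_lt_arccos (by norm_num) (by norm_num; linarith) (by linarith)⟩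
  have hin : ∀ a ∈ Set.Ioo (arccos (-0.4)) (arccos (-0.6)), a ∈ Set.Ioo 0 π := fun a ha =>
    (neg_cos_mem_of_mem (by norm_num) (by norm_num) (by norm_num) (by norm_num) ha).1
  refine ⟨hmem, ?_, fun a ha hb => ?_⟩
  · rw [beta_eq_self_iff hℓ (hin _ hmem), cos_arccos (by linarith) (by linarith), neg_neg, ← hε]
  · rw [beta_eq_self_iff hℓ (hin _ ha), ← hε, ← ht] at hb
    rw [← hb, neg_neg, arccos_cos (hin a ha).1.le (hin a ha).2.le]

theorem IsThreeBody.nonneg_of_le_pi {v₃ : ℝ → ℝ} (h : IsThreeBody v₃) :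
    ∀ x ∈ Set.Icc 0 π, 0 ≤ v₃ x :=
  fun x hx => h.nonneg x ⟨hx.1, by linarith [hx.2, pi_pos]⟩

end Nanotube

/-! ### Assembly of the fracture theorem -/

open Nanotube in
theorem theorem3p5 (v₂ v₃ : ℝ → ℝ) (h₂ : Nanotube.IsTwoBody v₂) (h₃ : Nanotube.IsThreeBody v₃) :
    ∃ a₁ a₂ : ℝ, Real.arccos (-0.3) ≤ a₁ ∧ a₂ ≤ Real.arccos (-0.55) ∧
    ∃ ℓ₀ : ℕ, 3 < ℓ₀ ∧ ∃ c : ℝ, 0 < c ∧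
    ∀ ℓ : ℕ, ℓ₀ ≤ ℓ →
      ∃ αus ∈ Set.Ioo a₁ a₂, Nanotube.IsUnstretchedAngle v₂ v₃ ℓ (Set.Ioo a₁ a₂) αus ∧
      ∃ μus : ℝ, μus = Nanotube.periodOfAngle αus ∧
      ∃ μ₁ μ₂ : ℝ, 2.6 ≤ μ₁ ∧ μ₂ ≤ 3.1 ∧ μus ∈ Set.Ioo μ₁ μ₂ ∧
      ∀ μ ∈ Set.Ioo μ₁ μ₂, ∃ lam : ℝ × ℝ, ∀ m : ℕ, 0 < m →
        (Nanotube.IsMinimizer v₂ v₃ ℓ m μ lam ∧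
          ∀ lam', Nanotube.IsMinimizer v₂ v₃ ℓ m μ lam' → lam' = lam) ∧
        (μus + c / Real.sqrt m ≤ μ →
          Nanotube.energy v₂ v₃ (Nanotube.cleaved ℓ m μus μ) <
            Nanotube.energy v₂ v₃ (Nanotube.tube ℓ m lam.1 lam.2 μ)) := by
  have hg := h₃.isWell
  set g : ℝ → ℝ := fun x => v₃ (arccos x) with hgdef
  obtain ⟨k, hk, r, hr, hv, hvm⟩ := h₂.exists_well
  obtain ⟨δ, hδ, hδ1, ε₀, hε₀, hε₀1, c₁, hc₁, hus⟩ := hg.exists_unstretched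
  have hone : (1 : ℝ) ∈ Set.Ioo 0.9 1.1 := by constructor <;> norm_num
  have hκ : 0 < min (k / 2) c₁ / 12 := by positivity
  set κ := min (k / 2) c₁ / 12 with hκdef
  have hδ1' : δ ≤ 1 / 20 := by norm_num at hδ1; exact hδ1
  have hε₀1' : ε₀ ≤ 1 / 10 := by norm_num at hε₀1; exact hε₀1
  -- In the variable t = -cos α the interval A is (1/2 - δ, 1/2 + δ). The bound ℓ₀ ensures ε < ε₀.
  -- In c, the summand 3/κ yields κc² > 3, and 10 makes the gap at least 10 and m large.
  refine ⟨arccos (-(1 / 2 - δ)), arccos (-(1 / 2 + δ)),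
    arccos_le_arccos (by norm_num; linarith), arccos_le_arccos (by norm_num; linarith),
    max 4 (⌈8 / ε₀⌉₊ + 1), by simp, 10 + 3 / κ, by positivity, fun ℓ hℓ => ?_⟩
  have hℓ3 : 3 < ℓ := lt_of_lt_of_le (by norm_num) ((le_max_left _ _).trans hℓ)
  have hℓpos : (0 : ℝ) < ℓ := by exact_mod_cast (by omega : 0 < ℓ)
  set ε := 1 - cos (π / ℓ) with hε
  have hεpos : 0 < ε := sub_pos.2 (cos_pi_div_lt_one hℓ3)
  have hεlt : ε < ε₀ := by
    refine one_sub_cos_pi_div_lt hε₀ (by omega) (lt_of_le_of_lt (Nat.le_ceil _) ?_)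
    exact_mod_cast lt_of_lt_of_le (Nat.lt_succ_self _) ((le_max_right _ _).trans hℓ)
  obtain ⟨t₀, ht₀, htch, hG, hconv, hd⟩ := hus ε hεpos hεlt
  obtain ⟨hch, hhalf⟩ := ht₀
  have hlow : 1 / 2 - δ < t₀ := htch.trans hch
  have hcos₀ : periodOfAngle (arccos (-t₀)) = 2 + 2 * t₀ := by
    rw [periodOfAngle, cos_arccos (by linarith) (by linarith)]
    ring
  have hE : ∀ m : ℕ, 0 < m → ∀ μ ∈ Set.Ioo 2.6 3.1, ∀ p : ℝ × ℝ, p.1 ∈ Set.Ioo 0.9 1.1 →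
      p.2 ∈ Set.Ioo 0.9 1.1 → energy v₂ v₃ (tube ℓ m p.1 p.2 μ)
        = 4 * m * ℓ * atomEnergy v₂ g ε μ p :=
    fun m hm μ hμ p h1 h2 => energy_tube hℓ3 hm hμ h1 h2
  have hE1 : ∀ m : ℕ, 0 < m → ∀ t, 1 / 2 - δ < t → t < 1 / 2 + δ →
      energy v₂ v₃ (tube ℓ m 1 1 (2 + 2 * t)) = 4 * m * ℓ * (-3 / 2 + angPot g ε t) := by
    intro m hm t h1 h2
    rw [hE m hm _ ⟨by norm_num; linarith, by norm_num; linarith⟩ (1, 1) hone hone]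
    simp only [atomEnergy, h₂.value_one, div_one]
    rw [show (2 + 2 * t) / 2 - 1 = t by ring]
    norm_num
  refine ⟨arccos (-t₀), ⟨arccos_lt_arccos (by linarith) (by linarith) (by linarith),
    arccos_lt_arccos (by linarith) (by linarith) (by linarith)⟩, ⟨fun m hm a ha hne => ?_,
    arccos (-((1 - ε) / (2 - ε))), isEqualAngle_arccos hℓ3 hε (by norm_num; linarith)
      (by norm_num; linarith), ⟨arccos_lt_arccos (by linarith) (by linarith) (by linarith), ?_⟩,
      Set.Ioo_subset_Ioo ?_ ?_⟩, _, rfl, ?_⟩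
  · obtain ⟨ha0, ha1, ha2⟩ := neg_cos_mem_of_mem (by linarith) (by linarith) (by linarith)
      (by linarith) ha
    have hm' : (0 : ℝ) < m := by exact_mod_cast hm
    have hper : periodOfAngle a = 2 + 2 * -cos a := by rw [periodOfAngle]; ring
    rw [hcos₀, hper, hE1 m hm _ hlow (by linarith), hE1 m hm _ ha1 ha2]
    have hne' : -cos a - t₀ ≠ 0 := by
      intro h0
      apply hne
      rw [show -t₀ = cos a by linarith, arccos_cos ha0.1.le ha0.2.le]
    have h1 := hG (-cos a) ⟨by linarith, by linarith⟩
    have h2 : 0 < c₁ * (-cos a - t₀) ^ 2 := by positivity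
    have h3 : 0 < 4 * (m : ℝ) * ℓ := by positivity
    exact mul_lt_mul_of_pos_left (by linarith) h3
  · rw [← arccos_neg_half]
    exact arccos_lt_arccos (by norm_num) (by linarith) (by linarith)
  · exact arccos_le_arccos (by linarith)
  · rw [← arccos_neg_half]
    exact arccos_le_arccos (by linarith)
  obtain ⟨R, hR, hR1, hmin⟩ := exists_unique_atomEnergy_minimizer h₂ hg hk hr hc₁ hεpos.le
    (by linarith) hv hvm hG hconv hd ⟨hlow, hhalf⟩ hδ1
  norm_num at hR1
  rw [hcos₀]
  refine ⟨2 + 2 * t₀ - R, 2 + 2 * t₀ + R, by norm_num; linarith, by norm_num; linarith,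
    ⟨by linarith, by linarith⟩, fun μ hμ => ?_⟩
  obtain ⟨p, hp1, hp2, hp⟩ := hmin μ (abs_lt.2 ⟨by linarith [hμ.1], by linarith [hμ.2]⟩)
  have hμI : μ ∈ Set.Ioo 2.6 3.1 :=
    ⟨by norm_num; linarith [hμ.1], by norm_num; linarith [hμ.2]⟩
  refine ⟨p, fun m hm => ?_⟩
  have hm' : (0 : ℝ) < m := by exact_mod_cast hm
  have hpos : 0 < 4 * (m : ℝ) * ℓ := by positivity
  refine ⟨⟨⟨hp1, hp2, fun q hq1 hq2 => ?_⟩, fun q hq => ?_⟩, fun hfar => ?_⟩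
  · rw [hE m hm μ hμI p hp1 hp2, hE m hm μ hμI q hq1 hq2]
    refine mul_le_mul_of_nonneg_left ?_ hpos.le
    by_cases hqp : q = p
    · rw [hqp]
    · exact (hp q hq1 hq2 hqp).le
  · by_contra hne
    obtain ⟨hq1, hq2, hqmin⟩ := hq
    have h1 := hqmin p hp1 hp2
    rw [hE m hm μ hμI p hp1 hp2, hE m hm μ hμI q hq1 hq2] at h1
    exact absurd (le_of_mul_le_mul_left h1 hpos) (not_le.2 (hp q hq1 hq2 hne))
  · have hs := Real.sqrt_pos.2 hm'
    have hss := Real.sq_sqrt hm'.le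
    set s := √(m : ℝ)
    set c := 10 + 3 / κ with hc
    have hc10 : 10 ≤ c := by
      have : 0 < 3 / κ := by positivity
      linarith
    have hgap : c / s ≤ μ - (2 + 2 * t₀) := by linarith
    rw [div_le_iff₀ hs] at hgap
    -- As μ - μus < R ≤ 1/10, the hypothesis on μ can hold only for √m ≥ 10c ≥ 100, so m ≥ 3 is
    -- automatic.
    have hs1 : 100 ≤ s := by
      have : (μ - (2 + 2 * t₀)) * s ≤ 1 / 10 * s :=
        mul_le_mul_of_nonneg_right (by linarith [hμ.2]) hs.le
      linarith
    have hm3 : 3 ≤ m := by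
      have : s * 1 ≤ s * s := mul_le_mul_of_nonneg_left (by linarith) hs.le
      have : (3 : ℝ) ≤ m := by rw [← hss, sq]; linarith
      exact_mod_cast this
    have hmd : 10 ≤ m * (μ - (2 + 2 * t₀)) := by
      calc (10 : ℝ) ≤ (μ - (2 + 2 * t₀)) * s * 1 := by linarith
        _ ≤ (μ - (2 + 2 * t₀)) * s * s := mul_le_mul_of_nonneg_left (by linarith) (by linarith)
        _ = m * (μ - (2 + 2 * t₀)) := by rw [← hss]; ring
    have hcl := energy_cleaved_le h₂.value_one h₃.nonneg_of_le_pi hℓ3 hm3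
      (μ₀ := 2 + 2 * t₀) ⟨by norm_num; linarith, by norm_num; linarith⟩ hmd
    rw [hE1 m hm t₀ hlow (by linarith)] at hcl
    rw [hE m hm μ hμI p hp1 hp2]
    have hgr := (atomEnergy_growth hk hc₁ hv hG hμI (Set.Ioo_subset_Icc_self hp1)
      (Set.Ioo_subset_Icc_self hp2)).2
    rw [← hκdef] at hgr
    have hsq : c ^ 2 ≤ m * (μ - (2 + 2 * t₀)) ^ 2 := by
      rw [← hss, mul_comm, ← mul_pow]
      exact pow_le_pow_left₀ (by linarith) hgap 2
    have hκc : 3 < κ * c ^ 2 := by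
      have h1 : κ * c = 10 * κ + 3 := by rw [hc]; field_simp
      calc (3 : ℝ) < κ * c * 1 := by linarith
        _ ≤ κ * c * c := mul_le_mul_of_nonneg_left (by linarith) (by positivity)
        _ = κ * c ^ 2 := by ring
    have h1 : κ * c ^ 2 ≤ κ * (m * (μ - (2 + 2 * t₀)) ^ 2) := mul_le_mul_of_nonneg_left hsq hκ.le
    have h2 : m * (κ * (μ - (2 + 2 * t₀)) ^ 2)
        ≤ m * (atomEnergy v₂ g ε μ p - (-3 / 2 + angPot g ε t₀)) :=
      mul_le_mul_of_nonneg_left hgr hm'.le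
    have h3 : 3 < m * (atomEnergy v₂ g ε μ p - (-3 / 2 + angPot g ε t₀)) := by linarith
    -- The excess of the stretched tube over the unstretched one is more than 4ℓ·3 = 12ℓ, the bound
    -- on the cost of cleaving.
    have h4 := mul_lt_mul_of_pos_left h3 (by positivity : 0 < 4 * (ℓ : ℝ))
    linarith
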